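/- Let $A(\mathbb R)$ be the space of functions $f:\mathbb R\to\mathbb C$ of the form $f(y)=\int_{\mathbb R} g(x)e^{ixy}\,dx$ for all $y\in\mathbb R$ with $g\in L_1(\mathbb R)$, normed by $\|f\|_A=\|g\|_{L_1(\mathbb R)}$. Consider continuous functions $f:\mathbb R\to\mathbb C$ that satisfy $f(t)\to 0$ as $|t|\to\infty$ and are locally absolutely continuous on $\mathbb R\setminus\{0\}$. For such $f$ put, with values in $[0,\infty]$, $$f_0(t)=\sup_{|s|\ge|t|}|f(s)|,\qquad f_1(t)=\operatorname*{ess\,sup}_{|s|\ge|t|>0}|f'(s)|,\qquad f_\infty(t)=\operatorname*{ess\,sup}_{0<|s|\le|t|}|f'(s)|.$$ (a) There is an absolute constant $c>0$ such that for every such $f$ the following holds. If $f'$ is a.e. bounded outside every neighborhood of $0$, and $$A_0=\int_1^\infty\frac{f_0(t)}{t}\,dt<\infty,\qquad A_1=\int_0^1 f_1(t)\ln\frac2t\,dt<\infty,\qquad A_{01}=\int_1^\infty\Bigl(\int_t^\infty f_0(s)f_1(s)\,ds\Bigr)^{1/2}\frac{dt}{t}<\infty,$$ then $f\in A(\mathbb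 R)$ and $\|f\|_A\le c\,(A_0+A_1+A_{01})$. (b) For every $\delta\in(0,1)$ there is a constant $\gamma(\delta)>0$, depending only on $\delta$, such that for every such $f$ the following holds. If $f'$ is not essentially bounded near infinity (that is, on $\{|s|\ge r\}$ for any $r>0$), $f(t)=0$ for $|t|\le2\pi$, $f_\infty(4\pi)>0$, and $$A_\delta^{1+\delta}=\sup_{t\ge2\pi}\,t\,f_0(t)^\delta f_\infty(t+2\pi)<\infty,$$ then $f\in A(\mathbb R)$ and $$\|f\|_A\le\gamma(\delta)\,A_\delta\Bigl(1+A_\delta^{1/\delta}\,f_\infty(4\pi)^{-1/\delta}\Bigr).$$ -/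

import Mathlib

open MeasureTheory Set
open scoped ENNReal NNReal ZeroAtInfty

noncomputable section

namespace FourierIntegral

/-- `f` is absolutely continuous on every compact interval of `ℝ` that does not contain `0`. -/
def LocallyACOffZero (f : ℝ → ℂ) : Prop :=
  ∀ a b : ℝ, (0 : ℝ) ∉ uIcc a b → AbsolutelyContinuousOnInterval f a b

/-- `f₀(t) = sup_{|s| ≥ |t|} |f(s)|`. -/
def f0 (f : ℝ → ℂ) (t : ℝ) : ℝ≥0∞ :=
  ⨆ (s : ℝ) (_ : |t| ≤ |s|), ‖f s‖ₑ

/-- `f₁(t) = ess sup_{|s| ≥ |t| > 0} |f'(s)|` (only used for `t ≠ 0`). A locally absolutely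
continuous function is differentiable almost everywhere, so the default value of `deriv` plays
no role. -/
def f1 (f : ℝ → ℂ) (t : ℝ) : ℝ≥0∞ :=
  essSup (fun s : ℝ => ‖deriv f s‖ₑ) (volume.restrict {s : ℝ | |t| ≤ |s|})

/-- `f_∞(t) = ess sup_{0 < |s| ≤ |t|} |f'(s)|`. -/
def fInf (f : ℝ → ℂ) (t : ℝ) : ℝ≥0∞ :=
  essSup (fun s : ℝ => ‖deriv f s‖ₑ) (volume.restrict {s : ℝ | 0 < |s| ∧ |s| ≤ |t|})

/-- `f'` is (essentially) bounded on `{|s| ≥ r}`. -/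
def DerivBoundedOutside (f : ℝ → ℂ) (r : ℝ) : Prop :=
  ∃ M : ℝ, ∀ᵐ s : ℝ, r ≤ |s| → ‖deriv f s‖ ≤ M

/-- `A₀ = ∫_1^∞ f₀(t)/t dt`. -/
def A0 (f : ℝ → ℂ) : ℝ≥0∞ :=
  ∫⁻ t in Ioi (1 : ℝ), f0 f t / ENNReal.ofReal t

/-- `A₁ = ∫_0^1 f₁(t) ln(2/t) dt`. -/
def A1 (f : ℝ → ℂ) : ℝ≥0∞ :=
  ∫⁻ t in Ioo (0 : ℝ) 1, f1 f t * ENNReal.ofReal (Real.log (2 / t))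

/-- `A₀₁ = ∫_1^∞ (∫_t^∞ f₀(s) f₁(s) ds)^{1/2} dt/t`. -/
def A01 (f : ℝ → ℂ) : ℝ≥0∞ :=
  ∫⁻ t in Ioi (1 : ℝ), (∫⁻ s in Ioi t, f0 f s * f1 f s) ^ (1 / 2 : ℝ) / ENNReal.ofReal t

/-- `A_δ`, where `A_δ^{1+δ} = sup_{t ≥ 2π} t f₀(t)^δ f_∞(t + 2π)`. -/
def ADelta (δ : ℝ) (f : ℝ → ℂ) : ℝ≥0∞ :=
  (⨆ (t : ℝ) (_ : 2 * Real.pi ≤ t),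
    ENNReal.ofReal t * f0 f t ^ δ * fInf f (t + 2 * Real.pi)) ^ (1 / (1 + δ))

/-- `g ∈ L₁(ℝ)` and `f(y) = ∫ g(x) e^{ixy} dx` for every `y`. -/
def IsRep (g f : ℝ → ℂ) : Prop :=
  Integrable g ∧ ∀ y : ℝ, f y = ∫ x : ℝ, g x * Complex.exp (Complex.I * (x * y))

/-- Membership in `A(ℝ)`. -/
def MemA (f : ℝ → ℂ) : Prop := ∃ g : ℝ → ℂ, IsRep g f

/-- `‖f‖_A = ‖g‖_{L₁}` where `g` represents `f`; since `g` is unique up to null sets, the infimum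
runs over a single value. It is `∞` when `f ∉ A(ℝ)`. -/
def normA (f : ℝ → ℂ) : ℝ≥0∞ :=
  ⨅ (g : ℝ → ℂ) (_ : IsRep g f), ∫⁻ x : ℝ, ‖g x‖ₑ

end FourierIntegral

end

/-! Everything rests on one estimate of Bernstein type: if h is bounded by H, has Lipschitz constant
K and is supported in an interval of length L, then its Fourier transform has L¹ norm at most
7√(HKL) (`lintegral_fourier_le`). It follows from Plancherel for h and for its differences h(x + s)
- h(x), combined by a weighted AM-GM inequality. The function f is cut into such pieces, and their
representing functions are summed in L¹ (`RepBound.of_telescope`).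

For (a) the pieces live on dyadic annuli a ≤ |t| ≤ 4a and cost a multiple of H + √(HDa), where H
bounds the function on the annulus and D = f₁(a) (`RepBound.mul_annulus`). For a = 2ⁿ ≥ 1 these
costs are compared with the integrals A₀ and A₀₁. Near the origin f(0) is subtracted first; then
both terms are controlled by the integral of f₁ over (0, 2⁻ⁿ). Summing over n counts each t about
log₂(2/t) times, which is the weight in A₁.

For (b) the derivative is unbounded at infinity, so the breakpoints must adapt to f. Put F_k =
f_∞(2πk + 2π) and Q_k = k F_k, and break at 2πm_j, where Q has just doubled. Up to the next
breakpoint, derivative bound times length is O(Q) with Q = Q_{m_j}, while finiteness of A_δ gives H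
≤ (M/Q)^{1/δ} with M = A_δ^{1+δ}. Since 1/δ > 1, √(HQ) decays geometrically in j. The ramps that
truncate f add a term H√(Q/F₁), which decays too (`RepBound.of_doubling`). -/

namespace FourierIntegral

/-! ### Plancherel for integrable, square-integrable functions -/

section Plancherel

open scoped FourierTransform SchwartzMap

theorem integral_fourier_mul_eq {f g : ℝ → ℂ} (hf : Integrable f) (hg : Integrable g) :
    ∫ ξ, 𝓕 f ξ * g ξ = ∫ x, f x * 𝓕 g x := by
  have := VectorFourier.integral_fourierIntegral_smul_eq_flip (f := f) (g := g) (μ := volume)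
    (ν := volume) (L := innerₗ ℝ) Real.continuous_fourierChar continuous_inner hf hg
  rwa [flip_innerₗ] at this

theorem continuous_fourier_of_integrable {f : ℝ → ℂ} (hf : Integrable f) : Continuous (𝓕 f) :=
  VectorFourier.fourierIntegral_continuous Real.continuous_fourierChar continuous_inner hf

/-- Both transforms act in the same way on test functions: the L² one through its tempered
distribution, the integral one by self-adjointness on L¹. -/
theorem fourier_toLp_ae_eq {f : ℝ → ℂ} (hf : Integrable f) (hf2 : MemLp f 2) :
    (𝓕 (hf2.toLp f) : Lp ℂ 2 (volume : Measure ℝ)) =ᵐ[volume] 𝓕 f := by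
  apply ae_eq_of_integral_contDiff_smul_eq
  · exact (Lp.memLp _).locallyIntegrable (by norm_num)
  · exact (continuous_fourier_of_integrable hf).locallyIntegrable
  · intro g g_smooth g_cpt
    have hg₁ : HasCompactSupport (Complex.ofRealCLM ∘ g) := g_cpt.comp_left rfl
    have hg₂ : ContDiff ℝ ((⊤ : ℕ∞) : WithTop ℕ∞) (Complex.ofRealCLM ∘ g) := by
      exact Complex.ofRealCLM.contDiff.comp g_smooth
    let φ : 𝓢(ℝ, ℂ) := hg₁.toSchwartzMap hg₂
    have hφ : ∀ x, φ x = (g x : ℂ) := fun x => rfl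
    have h1 := congrArg (fun T => T φ) (Lp.fourier_toTemperedDistribution_eq (hf2.toLp f))
    simp only [TemperedDistribution.fourier_apply, Lp.toTemperedDistribution_apply] at h1
    have h2 := integral_fourier_mul_eq hf φ.integrable
    calc _ = ∫ x, φ x • (𝓕 (hf2.toLp f) : Lp ℂ 2 (volume : Measure ℝ)) x := by
            simp [hφ]
      _ = ∫ x, 𝓕 φ x • (hf2.toLp f) x := h1.symm
      _ = ∫ x, f x * 𝓕 φ x := by
            apply integral_congr_ae
            filter_upwards [hf2.coeFn_toLp] with x hx
            rw [hx, smul_eq_mul, mul_comm]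
      _ = ∫ ξ, 𝓕 f ξ * φ ξ := by rw [h2]; rfl
      _ = _ := by simp [hφ, mul_comm]

theorem lintegral_fourier_sq {f : ℝ → ℂ} (hf : Integrable f) (hf2 : MemLp f 2) :
    ∫⁻ ξ, ‖𝓕 f ξ‖ₑ ^ 2 = ∫⁻ x, ‖f x‖ₑ ^ 2 := by
  have h : eLpNorm (𝓕 f) 2 volume = eLpNorm f 2 volume := by
    rw [← eLpNorm_congr_ae (fourier_toLp_ae_eq hf hf2), ← eLpNorm_congr_ae hf2.coeFn_toLp,
      ← Lp.enorm_def, ← Lp.enorm_def, ← ofReal_norm, ← ofReal_norm,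
      Lp.norm_fourier_eq]
  have h2 := congrArg (· ^ (2 : ℝ)) h
  simp only [eLpNorm_eq_lintegral_rpow_enorm_toReal (p := 2) (by norm_num) (by norm_num)] at h2
  simp only [← ENNReal.rpow_mul] at h2
  simpa using h2

theorem fourier_comp_add_right (f : ℝ → ℂ) (s ξ : ℝ) :
    𝓕 (fun x => f (x + s)) ξ = Complex.exp (Complex.I * ((2 * Real.pi * (s * ξ) : ℝ) : ℂ)) * 𝓕 f ξ := by
  have := congrFun (VectorFourier.fourierIntegral_comp_add_right Real.fourierChar volume (innerₗ ℝ)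
    f s) ξ
  have e : (Real.fourierChar (innerₗ ℝ s ξ) : ℂ)
      = Complex.exp (Complex.I * ((2 * Real.pi * (s * ξ) : ℝ) : ℂ)) := by
    rw [Real.fourierChar_apply]
    simp only [innerₗ_apply_apply, RCLike.inner_apply, conj_trivial]
    push_cast
    ring_nf
  rw [← e]
  exact this

end Plancherel

/-! ### Fourier transforms of compactly supported Lipschitz functions -/

section

open scoped FourierTransform

theorem lintegral_sq_le_of_support {h : ℝ → ℂ} {H a b : ℝ} (hH : ∀ x, ‖h x‖ ≤ H)
    (hs : ∀ x, x ∉ Icc a b → h x = 0) :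
    ∫⁻ x, ‖h x‖ₑ ^ 2 ≤ ENNReal.ofReal (H ^ 2 * (b - a)) := by
  have hH0 : 0 ≤ H := (norm_nonneg _).trans (hH 0)
  calc ∫⁻ x, ‖h x‖ₑ ^ 2 ≤ ∫⁻ x, (Icc a b).indicator (fun _ => ENNReal.ofReal (H ^ 2)) x := by
        apply lintegral_mono
        intro x
        by_cases hx : x ∈ Icc a b
        · simp only [indicator_of_mem hx]
          rw [← ofReal_norm, ← ENNReal.ofReal_pow (norm_nonneg _)]
          exact ENNReal.ofReal_le_ofReal (by gcongr; exact hH x)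
        · simp [hs x hx]
    _ = _ := by
        rw [lintegral_indicator measurableSet_Icc, lintegral_const, Measure.restrict_apply_univ,
          Real.volume_Icc, ENNReal.ofReal_mul (by positivity)]

theorem continuous_of_norm_sub_le {h : ℝ → ℂ} {K : ℝ} (hK : ∀ x y, ‖h x - h y‖ ≤ K * |x - y|) :
    Continuous h := by
  have hK0 : 0 ≤ K := by simpa using (norm_nonneg _).trans (hK 1 0)
  refine LipschitzWith.continuous (K := K.toNNReal) (LipschitzWith.of_dist_le_mul fun x y => ?_)
  rw [dist_eq_norm, Real.dist_eq, Real.coe_toNNReal _ hK0]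
  exact hK x y

theorem hasCompactSupport_of_Icc {h : ℝ → ℂ} {a b : ℝ} (hs : ∀ x, x ∉ Icc a b → h x = 0) :
    HasCompactSupport h :=
  HasCompactSupport.intro isCompact_Icc (fun x hx => hs x hx)

/-- Plancherel is applied to g(x) = h(x + s) - h(x), which is at most Ks in size and lives on [a -
s, b]. Its transform is (e^{2πisξ} - 1) times that of h, and on |ξ| ≤ 1/(2s) this factor is at least
s|ξ|. No derivative of h is needed. -/
theorem setLIntegral_fourier_le {h : ℝ → ℂ} {K a b s : ℝ}
    (hK : ∀ x y, ‖h x - h y‖ ≤ K * |x - y|) (hs : ∀ x, x ∉ Icc a b → h x = 0)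
    (hs0 : 0 < s) :
    ∫⁻ ξ in Icc (-(1 / (2 * s))) (1 / (2 * s)), ENNReal.ofReal (ξ ^ 2) * ‖𝓕 h ξ‖ₑ ^ 2
      ≤ ENNReal.ofReal (K ^ 2 * (b - a + s)) := by
  have hc := continuous_of_norm_sub_le hK
  have hi : Integrable h := hc.integrable_of_hasCompactSupport (hasCompactSupport_of_Icc hs)
  set g : ℝ → ℂ := fun x => h (x + s) - h x with hg
  have hgs : ∀ x, x ∉ Icc (a - s) b → g x = 0 := by
    intro x hx
    have h1 : x + s ∉ Icc a b := fun h' => hx ⟨by linarith [h'.1], by linarith [h'.2]⟩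
    have h2 : x ∉ Icc a b := fun h' => hx ⟨by linarith [h'.1], h'.2⟩
    simp [hg, hs _ h1, hs _ h2]
  have hgc : Continuous g := by fun_prop
  have hgi := hgc.integrable_of_hasCompactSupport (μ := volume) (hasCompactSupport_of_Icc hgs)
  have hg2 := hgc.memLp_of_hasCompactSupport (μ := volume) (p := 2) (hasCompactSupport_of_Icc hgs)
  have hgH : ∀ x, ‖g x‖ ≤ K * s := by
    intro x
    have := hK (x + s) x
    simpa [abs_of_pos hs0] using this
  have hFg : ∀ ξ, 𝓕 g ξ = (Complex.exp (Complex.I * ((2 * Real.pi * (s * ξ) : ℝ) : ℂ)) - 1) * 𝓕 h ξ := by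
    intro ξ
    have h1 : g = (fun x => h (x + s)) + fun x => (-1 : ℂ) * h x := by
      ext x; simp [hg]; ring
    have h2 := fourier_comp_add_right h s ξ
    rw [Real.fourier_eq] at h2 ⊢
    have h3 : 𝓕 h ξ = ∫ v, Real.fourierChar (-inner ℝ v ξ) • h v := Real.fourier_eq h ξ
    rw [sub_mul, one_mul, ← h2, h3, ← integral_sub]
    · congr 1; ext v; simp [hg, smul_sub]
    · exact (Real.fourierIntegral_convergent_iff ξ).2 (hi.comp_add_right s)
    · exact (Real.fourierIntegral_convergent_iff ξ).2 hi
  have key := lintegral_sq_le_of_support hgH hgs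
  rw [← lintegral_fourier_sq hgi hg2] at key
  have hpt : ∀ ξ ∈ Icc (-(1 / (2 * s))) (1 / (2 * s)),
      ENNReal.ofReal (s ^ 2) * (ENNReal.ofReal (ξ ^ 2) * ‖𝓕 h ξ‖ₑ ^ 2) ≤ ‖𝓕 g ξ‖ₑ ^ 2 := by
    intro ξ hξ
    have hab : |ξ| * (2 * s) ≤ 1 := by
      have := abs_le.2 hξ
      rwa [le_div_iff₀ (by positivity)] at this
    rw [hFg, enorm_mul, mul_pow, ← mul_assoc]
    gcongr
    rw [← ENNReal.ofReal_mul (by positivity), ← ofReal_norm, ← ENNReal.ofReal_pow (norm_nonneg _)]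
    apply ENNReal.ofReal_le_ofReal
    rw [← mul_pow, Complex.norm_exp_I_mul_ofReal_sub_one, Real.norm_eq_abs, sq_abs]
    apply sq_le_sq.2
    rw [abs_mul, abs_mul, abs_two, abs_of_pos hs0]
    have h4 : |2 * Real.pi * (s * ξ) / 2| = Real.pi * (s * |ξ|) := by
      rw [abs_div, abs_mul, abs_mul, abs_mul, abs_two, abs_of_pos Real.pi_pos, abs_of_pos hs0]
      ring
    -- Jordan's inequality at πsξ, which lies in [-π/2, π/2] because |ξ| ≤ 1/(2s).
    have h5 := Real.mul_abs_le_abs_sin (x := 2 * Real.pi * (s * ξ) / 2) (by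
      rw [h4]; nlinarith [Real.pi_pos])
    rw [h4] at h5
    have h6 : 2 / Real.pi * (Real.pi * (s * |ξ|)) = 2 * (s * |ξ|) := by
      field_simp
    have : 0 ≤ s * |ξ| := by positivity
    nlinarith
  have h7 : ENNReal.ofReal (s ^ 2) *
      ∫⁻ ξ in Icc (-(1 / (2 * s))) (1 / (2 * s)), ENNReal.ofReal (ξ ^ 2) * ‖𝓕 h ξ‖ₑ ^ 2
      ≤ ENNReal.ofReal (s ^ 2) * ENNReal.ofReal (K ^ 2 * (b - a + s)) := by
    rw [← lintegral_const_mul' _ _ ENNReal.ofReal_ne_top, ← ENNReal.ofReal_mul (by positivity)]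
    calc _ ≤ ∫⁻ ξ in Icc (-(1 / (2 * s))) (1 / (2 * s)), ‖𝓕 g ξ‖ₑ ^ 2 :=
          setLIntegral_mono' measurableSet_Icc hpt
      _ ≤ ∫⁻ ξ, ‖𝓕 g ξ‖ₑ ^ 2 := setLIntegral_le_lintegral _ _
      _ ≤ _ := key
      _ = _ := by congr 1; ring
  exact (ENNReal.mul_le_mul_iff_right (by simpa using hs0.ne') ENNReal.ofReal_ne_top).1 h7

theorem lintegral_sq_mul_fourier_le {h : ℝ → ℂ} {K a b : ℝ}
    (hK : ∀ x y, ‖h x - h y‖ ≤ K * |x - y|) (hs : ∀ x, x ∉ Icc a b → h x = 0) (hab : a < b) :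
    ∫⁻ ξ, ENNReal.ofReal (ξ ^ 2) * ‖𝓕 h ξ‖ₑ ^ 2 ≤ ENNReal.ofReal (2 * (K ^ 2 * (b - a))) := by
  set L := b - a with hL
  have hL0 : 0 < L := sub_pos.2 hab
  let r : ℕ → ℝ := fun n => (n + 1) / (2 * L)
  have hr : Monotone r := by
    intro m n hmn
    have : (m : ℝ) ≤ n := by exact_mod_cast hmn
    simp only [r]; gcongr
  have hU : ⋃ n, Icc (-(r n)) (r n) = univ := by
    refine eq_univ_of_forall fun x => mem_iUnion.2 ?_
    obtain ⟨n, hn⟩ := exists_nat_ge (|x| * (2 * L))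
    refine ⟨n, abs_le.1 ?_⟩
    simp only [r]
    rw [le_div_iff₀ (by positivity)]
    linarith
  rw [← setLIntegral_univ, ← hU, setLIntegral_iUnion_of_directed]
  · refine iSup_le fun n => ?_
    have hn : (1 : ℝ) ≤ n + 1 := by linarith [Nat.cast_nonneg (α := ℝ) n]
    -- With s = L/(n + 1) the frequency windows exhaust the line, while L + s ≤ 2L; this is the
    -- factor 2.
    have := setLIntegral_fourier_le hK hs (s := L / (n + 1)) (by positivity)
    have e : 1 / (2 * (L / ((n : ℝ) + 1))) = r n := by simp only [r]; field_simp
    rw [e] at this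
    refine this.trans (ENNReal.ofReal_le_ofReal ?_)
    have : L / (n + 1) ≤ L := div_le_self hL0.le hn
    nlinarith [sq_nonneg K]
  · intro m n
    refine ⟨max m n, ?_, ?_⟩
    · exact Icc_subset_Icc (neg_le_neg (hr (le_max_left _ _))) (hr (le_max_left _ _))
    · exact Icc_subset_Icc (neg_le_neg (hr (le_max_right _ _))) (hr (le_max_right _ _))

end

/-! ### The basic L¹ bound -/

section

open scoped FourierTransform

/-- Pointwise u ≤ w u² + 1/w with the weight w = α(R² + ξ²). The quadratic terms are controlled by
the two L² bounds, and 1/w is integrable. -/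
theorem lintegral_fourier_le {h : ℝ → ℂ} {H K a b : ℝ} (hH0 : 0 < H) (hK0 : 0 < K)
    (hH : ∀ x, ‖h x‖ ≤ H) (hK : ∀ x y, ‖h x - h y‖ ≤ K * |x - y|)
    (hs : ∀ x, x ∉ Icc a b → h x = 0) (hab : a < b) :
    ∫⁻ ξ, ‖𝓕 h ξ‖ₑ ≤ ENNReal.ofReal (7 * √(H * K * (b - a))) := by
  have hc := continuous_of_norm_sub_le hK
  have hcs := hasCompactSupport_of_Icc hs
  have hi : Integrable h := hc.integrable_of_hasCompactSupport hcs
  have hFm : Measurable (𝓕 h) := (continuous_fourier_of_integrable hi).measurable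
  have hL0 : 0 < b - a := sub_pos.2 hab
  set L := b - a with hL
  set q := √(H * K * L) with hq
  have hq0 : 0 < q := by positivity
  have hqq : q ^ 2 = H * K * L := Real.sq_sqrt (by positivity)
  have e1 : ∫⁻ ξ, ‖𝓕 h ξ‖ₑ ^ 2 ≤ ENNReal.ofReal (H ^ 2 * L) :=
    (lintegral_fourier_sq hi (hc.memLp_of_hasCompactSupport hcs)).trans_le
      (lintegral_sq_le_of_support hH hs)
  have e2 := lintegral_sq_mul_fourier_le hK hs hab
  -- R balances the two L² bounds and α the weight: the three terms become q, 2q and πq, and 3 + π ≤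
  -- 7.
  set R := K / H with hR
  set α := q / (K ^ 2 * L) with hα
  have hR0 : 0 < R := by positivity
  have hα0 : 0 < α := by positivity
  have e3 : ∫⁻ ξ, ENNReal.ofReal (α⁻¹ * (R ^ 2)⁻¹ * (1 + (ξ / R) ^ 2)⁻¹)
      = ENNReal.ofReal (α⁻¹ * (R ^ 2)⁻¹ * (R * Real.pi)) := by
    rw [← ofReal_integral_eq_lintegral_ofReal]
    · rw [integral_const_mul, Measure.integral_comp_div (fun x : ℝ => (1 + x ^ 2)⁻¹) R,
        integral_univ_inv_one_add_sq, abs_of_pos hR0, smul_eq_mul]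
    · exact (integrable_inv_one_add_sq.comp_div hR0.ne').const_mul _
    · exact Filter.Eventually.of_forall fun x => by positivity
  calc ∫⁻ ξ, ‖𝓕 h ξ‖ₑ
      ≤ ∫⁻ ξ, (ENNReal.ofReal (α * R ^ 2) * ‖𝓕 h ξ‖ₑ ^ 2
          + ENNReal.ofReal α * (ENNReal.ofReal (ξ ^ 2) * ‖𝓕 h ξ‖ₑ ^ 2)
          + ENNReal.ofReal (α⁻¹ * (R ^ 2)⁻¹ * (1 + (ξ / R) ^ 2)⁻¹)) := by
        apply lintegral_mono
        intro ξ
        simp only [← ofReal_norm]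
        rw [← ENNReal.ofReal_pow (norm_nonneg _), ← ENNReal.ofReal_mul (by positivity),
          ← ENNReal.ofReal_mul (by positivity), ← ENNReal.ofReal_mul (by positivity),
          ← ENNReal.ofReal_add (by positivity) (by positivity),
          ← ENNReal.ofReal_add (by positivity) (by positivity)]
        apply ENNReal.ofReal_le_ofReal
        set u := ‖𝓕 h ξ‖
        have hw : 0 < α * (R ^ 2 + ξ ^ 2) := by positivity
        have e : α⁻¹ * (R ^ 2)⁻¹ * (1 + (ξ / R) ^ 2)⁻¹ = (α * (R ^ 2 + ξ ^ 2))⁻¹ := by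
          field_simp
        rw [e]
        set w := α * (R ^ 2 + ξ ^ 2) with hwd
        have : α * R ^ 2 * u ^ 2 + α * (ξ ^ 2 * u ^ 2) = w * u ^ 2 := by rw [hwd]; ring
        rw [this]
        have h2 : w * u ^ 2 + w⁻¹ - u = w⁻¹ * ((w * u - 1 / 2) ^ 2 + 3 / 4) := by
          field_simp; ring
        have : 0 ≤ w⁻¹ * ((w * u - 1 / 2) ^ 2 + 3 / 4) := by positivity
        linarith
    _ = ENNReal.ofReal (α * R ^ 2) * (∫⁻ ξ, ‖𝓕 h ξ‖ₑ ^ 2)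
          + ENNReal.ofReal α * (∫⁻ ξ, ENNReal.ofReal (ξ ^ 2) * ‖𝓕 h ξ‖ₑ ^ 2)
          + ENNReal.ofReal (α⁻¹ * (R ^ 2)⁻¹ * (R * Real.pi)) := by
        rw [lintegral_add_left (by fun_prop), lintegral_add_left (by fun_prop),
          lintegral_const_mul' _ _ ENNReal.ofReal_ne_top,
          lintegral_const_mul' _ _ ENNReal.ofReal_ne_top, e3]
    _ ≤ ENNReal.ofReal (α * R ^ 2) * ENNReal.ofReal (H ^ 2 * L)
          + ENNReal.ofReal α * ENNReal.ofReal (2 * (K ^ 2 * L))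
          + ENNReal.ofReal (α⁻¹ * (R ^ 2)⁻¹ * (R * Real.pi)) := by gcongr
    _ = ENNReal.ofReal (α * R ^ 2 * (H ^ 2 * L) + α * (2 * (K ^ 2 * L))
          + α⁻¹ * (R ^ 2)⁻¹ * (R * Real.pi)) := by
        rw [← ENNReal.ofReal_mul (by positivity), ← ENNReal.ofReal_mul (by positivity),
          ← ENNReal.ofReal_add (by positivity) (by positivity),
          ← ENNReal.ofReal_add (by positivity) (by positivity)]
    _ ≤ _ := by
        apply ENNReal.ofReal_le_ofReal
        have t1 : α * R ^ 2 * (H ^ 2 * L) = q := by rw [hα, hR]; field_simp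
        have t2 : α * (2 * (K ^ 2 * L)) = 2 * q := by rw [hα]; field_simp
        have t3 : α⁻¹ * (R ^ 2)⁻¹ * (R * Real.pi) = Real.pi * q := by
          have : α⁻¹ * (R ^ 2)⁻¹ * (R * Real.pi) = Real.pi * (H * K * L) / q := by
            rw [hα, hR]; field_simp
          rw [this, ← hqq]; field_simp
        rw [t1, t2, t3]
        nlinarith [Real.pi_lt_four]

/-! ### Operations on representing functions -/

/-- `f` has a representing function of `L¹`-norm at most `C`. -/
def RepBound (f : ℝ → ℂ) (C : ℝ≥0∞) : Prop := ∃ g, IsRep g f ∧ ∫⁻ x, ‖g x‖ₑ ≤ C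

namespace RepBound

theorem memA {f : ℝ → ℂ} {C : ℝ≥0∞} (h : RepBound f C) : MemA f := ⟨h.choose, h.choose_spec.1⟩

theorem normA_le {f : ℝ → ℂ} {C : ℝ≥0∞} (h : RepBound f C) : normA f ≤ C := by
  obtain ⟨g, hg, hC⟩ := h
  exact (iInf₂_le g hg).trans hC

theorem mono {f : ℝ → ℂ} {C D : ℝ≥0∞} (h : RepBound f C) (hCD : C ≤ D) : RepBound f D :=
  let ⟨g, hg, hC⟩ := h
  ⟨g, hg, hC.trans hCD⟩

theorem zero : RepBound (fun _ => 0) 0 :=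
  ⟨fun _ => 0, ⟨integrable_zero _ _ _, by simp⟩, by simp⟩

theorem integrable_mul_exp {g : ℝ → ℂ} (hg : Integrable g) (y : ℝ) :
    Integrable fun x : ℝ => g x * Complex.exp (Complex.I * (x * y)) := by
  refine hg.norm.mono (hg.1.mul (by fun_prop)) (Filter.Eventually.of_forall fun x => ?_)
  rw [norm_mul, ← Complex.ofReal_mul, mul_comm Complex.I, Complex.norm_exp_ofReal_mul_I]
  simp

theorem norm_mul_exp_eq (g : ℝ → ℂ) (y : ℝ) (x : ℝ) :
    ‖g x * Complex.exp (Complex.I * (x * y))‖ = ‖g x‖ := by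
  rw [norm_mul, ← Complex.ofReal_mul, mul_comm Complex.I, Complex.norm_exp_ofReal_mul_I, mul_one]

theorem add {f₁ f₂ : ℝ → ℂ} {C D : ℝ≥0∞} (h₁ : RepBound f₁ C) (h₂ : RepBound f₂ D) :
    RepBound (fun x => f₁ x + f₂ x) (C + D) := by
  obtain ⟨g₁, ⟨hi₁, he₁⟩, hC₁⟩ := h₁
  obtain ⟨g₂, ⟨hi₂, he₂⟩, hC₂⟩ := h₂
  refine ⟨fun x => g₁ x + g₂ x, ⟨hi₁.add hi₂, fun y => ?_⟩, ?_⟩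
  · simp only [he₁ y, he₂ y, add_mul]
    rw [integral_add (integrable_mul_exp hi₁ y) (integrable_mul_exp hi₂ y)]
  · calc _ ≤ ∫⁻ x, (‖g₁ x‖ₑ + ‖g₂ x‖ₑ) := lintegral_mono fun x => enorm_add_le _ _
      _ = _ := lintegral_add_left' hi₁.1.enorm _
      _ ≤ _ := add_le_add hC₁ hC₂

theorem comp_neg {f : ℝ → ℂ} {C : ℝ≥0∞} (h : RepBound f C) : RepBound (fun x => f (-x)) C := by
  obtain ⟨g, ⟨hi, he⟩, hC⟩ := h
  refine ⟨fun x => g (-x), ⟨hi.comp_neg, fun y => ?_⟩, ?_⟩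
  · simp only [he]
    rw [← integral_neg_eq_self]
    congr 1; ext x; push_cast; ring_nf
  · rw [← lintegral_neg_eq_self] at hC
    exact hC

theorem tsum {f : ℝ → ℂ} {h : ℕ → ℝ → ℂ} {c : ℕ → ℝ≥0∞} (hh : ∀ n, RepBound (h n) (c n))
    (hc : ∑' n, c n ≠ ∞)
    (hf : ∀ y, Filter.Tendsto (fun n => ∑ i ∈ Finset.range n, h i y) Filter.atTop (nhds (f y))) :
    RepBound f (∑' n, c n) := by
  choose g hg hgc using hh
  have hgi : ∀ n, Integrable (g n) := fun n => (hg n).1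
  have hfin : ∑' n, ∫⁻ x, ‖g n x‖ₑ ≠ ∞ := ne_top_of_le_ne_top hc (ENNReal.tsum_le_tsum hgc)
  have hlt : ∫⁻ x, ∑' n, ‖g n x‖ₑ = ∑' n, ∫⁻ x, ‖g n x‖ₑ :=
    lintegral_tsum fun n => (hgi n).1.enorm
  have hae : ∀ᵐ x, ∑' n, ‖g n x‖ₑ < ∞ :=
    ae_lt_top' (AEMeasurable.tsum fun n => (hgi n).1.enorm) (by rwa [hlt])
  have hsm : ∀ᵐ x, Summable fun n => g n x := by
    filter_upwards [hae] with x hx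
    have : Summable fun n => ‖g n x‖₊ := ENNReal.tsum_coe_ne_top_iff_summable.1 hx.ne
    exact Summable.of_nnnorm this
  have hle : ∫⁻ x, ‖∑' n, g n x‖ₑ ≤ ∑' n, c n :=
    calc _ ≤ ∫⁻ x, ∑' n, ‖g n x‖ₑ := lintegral_mono fun x => enorm_tsum_le_tsum_enorm
      _ = _ := hlt
      _ ≤ _ := ENNReal.tsum_le_tsum hgc
  have hm : AEStronglyMeasurable (fun x => ∑' n, g n x) volume := by
    refine aestronglyMeasurable_of_tendsto_ae Filter.atTop
      (f := fun n x => ∑ i ∈ Finset.range n, g i x) (fun n => ?_) ?_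
    · exact Finset.aestronglyMeasurable_fun_sum _ fun i _ => (hgi i).1
    · filter_upwards [hsm] with x hx using hx.hasSum.tendsto_sum_nat
  refine ⟨fun x => ∑' n, g n x, ⟨⟨hm, hle.trans_lt hc.lt_top⟩, fun y => ?_⟩, hle⟩
  have hS := hasSum_integral_of_summable_integral_norm
    (F := fun n (x : ℝ) => g n x * Complex.exp (Complex.I * (x * y)))
    (fun n => integrable_mul_exp (hgi n) y) (by
      simp only [norm_mul_exp_eq]
      have : ∀ n, ∫ x, ‖g n x‖ = (∫⁻ x, ‖g n x‖ₑ).toReal := fun n =>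
        integral_norm_eq_lintegral_enorm (hgi n).1
      simp only [this]
      exact ENNReal.summable_toReal hfin)
  simp only [tsum_mul_right] at hS
  refine tendsto_nhds_unique (hf y) ?_
  simp only [fun n => (hg n).2 y]
  exact hS.tendsto_sum_nat

theorem of_telescope {f : ℝ → ℂ} {S : ℕ → ℝ → ℂ} {c : ℕ → ℝ≥0∞} {C : ℝ≥0∞}
    (h0 : RepBound (S 0) C) (hh : ∀ n, RepBound (fun y => S (n + 1) y - S n y) (c n))
    (hc : ∑' n, c n ≠ ∞)
    (hf : ∀ y, Filter.Tendsto (fun n => S n y) Filter.atTop (nhds (f y))) :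
    RepBound f (C + ∑' n, c n) := by
  have := h0.add (tsum (f := fun y => f y - S 0 y) hh hc fun y => by
    simp only [Finset.sum_range_sub (fun n => S n y)]
    exact (hf y).sub_const _)
  simpa using this

/-- Fourier inversion; rescaling by 2π turns the kernel e^{2πixy} into e^{ixy} and preserves the L¹
norm. -/
theorem of_lipschitz {h : ℝ → ℂ} {H K a b : ℝ}
    (hH : ∀ x, ‖h x‖ ≤ H) (hK : ∀ x y, ‖h x - h y‖ ≤ K * |x - y|)
    (hs : ∀ x, x ∉ Icc a b → h x = 0) (hab : a < b) :
    RepBound h (ENNReal.ofReal (7 * √(H * K * (b - a)))) := by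
  have hH0 : 0 ≤ H := (norm_nonneg _).trans (hH 0)
  have hK0 : 0 ≤ K := by simpa using (norm_nonneg _).trans (hK 1 0)
  by_cases hz : h = fun _ => 0
  · rw [hz]; exact zero.mono zero_le
  -- H = 0 forces h = 0, and so does K = 0, since h is then constant and vanishes at b + 1.
  have hH0' : 0 < H := by
    refine hH0.lt_of_ne fun e => hz (funext fun x => ?_)
    have := hH x
    rw [← e] at this
    simpa using this
  have hK0' : 0 < K := by
    refine hK0.lt_of_ne fun e => hz (funext fun x => ?_)
    have := hK x (b + 1)
    rw [← e, hs (b + 1) (fun h' => by linarith [h'.2])] at this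
    simpa using this
  have hc := continuous_of_norm_sub_le hK
  have hi : Integrable h := hc.integrable_of_hasCompactSupport (hasCompactSupport_of_Icc hs)
  have hle := lintegral_fourier_le hH0' hK0' hH hK hs hab
  have hFi : Integrable (𝓕 h) :=
    ⟨(continuous_fourier_of_integrable hi).aestronglyMeasurable,
      hle.trans_lt ENNReal.ofReal_lt_top⟩
  have hinv := hc.fourierInv_fourier_eq hi hFi
  have h2π : (2 * Real.pi) ≠ 0 := by positivity
  have hgi : Integrable fun x : ℝ => ((2 * Real.pi)⁻¹ : ℝ) • 𝓕 h (x / (2 * Real.pi)) :=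
    Integrable.smul (2 * Real.pi)⁻¹ (hFi.comp_div h2π)
  refine ⟨fun x => ((2 * Real.pi)⁻¹ : ℝ) • 𝓕 h (x / (2 * Real.pi)), ⟨hgi, fun y => ?_⟩, ?_⟩
  · have e1 : (fun x : ℝ => (((2 * Real.pi)⁻¹ : ℝ) • 𝓕 h (x / (2 * Real.pi)))
        * Complex.exp (Complex.I * (x * y))) =
        fun x : ℝ => (fun v : ℝ => ((2 * Real.pi)⁻¹ : ℝ) •
          (Complex.exp (((2 * Real.pi * inner ℝ v y : ℝ) : ℂ) * Complex.I) • 𝓕 h v)) (x / (2 * Real.pi)) := by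
      ext x
      simp only [smul_mul_assoc, smul_eq_mul]
      congr 1
      rw [mul_comm]
      congr 2
      simp only [RCLike.inner_apply, conj_trivial]
      have : 2 * Real.pi * (y * (x / (2 * Real.pi))) = x * y := by field_simp
      rw [this]; push_cast; ring
    rw [e1, Measure.integral_comp_div (fun v : ℝ => ((2 * Real.pi)⁻¹ : ℝ) •
      (Complex.exp (((2 * Real.pi * inner ℝ v y : ℝ) : ℂ) * Complex.I) • 𝓕 h v)), integral_smul, ← Real.fourierInv_eq', hinv, smul_smul,
      abs_of_pos (by positivity), mul_inv_cancel₀ h2π, one_smul]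
  · have e2 : ∫ x, ‖((2 * Real.pi)⁻¹ : ℝ) • 𝓕 h (x / (2 * Real.pi))‖ = ∫ ξ, ‖𝓕 h ξ‖ := by
      simp only [norm_smul]
      rw [integral_const_mul, Measure.integral_comp_div (fun v => ‖𝓕 h v‖), norm_inv,
        Real.norm_eq_abs, smul_eq_mul, inv_mul_cancel_left₀ (abs_ne_zero.2 h2π)]
    rw [integral_norm_eq_lintegral_enorm hgi.1, integral_norm_eq_lintegral_enorm hFi.1] at e2
    rw [(ENNReal.toReal_eq_toReal_iff' hgi.2.ne hFi.2.ne).1 e2]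
    exact hle

end RepBound

end

/-! ### Mean value inequality, cutoffs and annular pieces -/

/-- The fundamental theorem of calculus is applied to the real function Re(z̄ f) with z = f(b) -
f(a); its increment over [a, b] is |z|². -/
theorem norm_sub_le_of_ae_norm_deriv_le {f : ℝ → ℂ} {a b D : ℝ} (hab : a ≤ b)
    (hf : AbsolutelyContinuousOnInterval f a b)
    (hD : ∀ᵐ s : ℝ, s ∈ Ioo a b → ‖deriv f s‖ ≤ D) : ‖f b - f a‖ ≤ D * (b - a) := by
  set z := f b - f a with hz
  let ℓ : ℂ →L[ℝ] ℝ := Complex.reCLM ∘L (ContinuousLinearMap.mul ℝ ℂ (starRingEnd ℂ z))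
  have hℓ : ∀ w, ℓ w = ((starRingEnd ℂ z) * w).re := fun w => rfl
  have hℓn : ∀ w, |ℓ w| ≤ ‖z‖ * ‖w‖ := fun w => by
    rw [hℓ]
    refine (Complex.abs_re_le_norm _).trans ?_
    rw [norm_mul, RCLike.norm_conj]
  have hφ : AbsolutelyContinuousOnInterval (fun x => ℓ (f x)) a b := by
    refine squeeze_zero (fun E => Finset.sum_nonneg fun i _ => dist_nonneg) (fun E => ?_)
      (by simpa using Filter.Tendsto.const_mul ‖z‖ hf)
    rw [Finset.mul_sum]
    refine Finset.sum_le_sum fun i _ => ?_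
    rw [Real.dist_eq, ← map_sub, dist_eq_norm]
    exact hℓn _
  have hdiff := hf.boundedVariationOn.ae_differentiableAt_of_mem_uIcc
  have hder : ∀ᵐ s : ℝ, s ∈ Ioo a b → ‖deriv (fun x => ℓ (f x)) s‖ ≤ ‖z‖ * D := by
    filter_upwards [hD, hdiff] with s h1 h2 hs
    have hd := h2 (by rw [uIcc_of_le hab]; exact Ioo_subset_Icc_self hs)
    have : HasDerivAt (fun x => ℓ (f x)) (ℓ (deriv f s)) s :=
      ℓ.hasFDerivAt.comp_hasDerivAt s hd.hasDerivAt
    rw [this.deriv]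
    exact (hℓn _).trans (by gcongr; exact h1 hs)
  have hint : ‖∫ x in a..b, deriv (fun x => ℓ (f x)) x‖ ≤ ‖z‖ * D * |b - a| := by
    refine intervalIntegral.norm_integral_le_of_norm_le_const_ae ?_
    have hb : ∀ᵐ s : ℝ, s ≠ b := by simp [ae_iff]
    filter_upwards [hder, hb] with s h1 hsb hs
    rw [uIoc_of_le hab] at hs
    exact h1 ⟨hs.1, lt_of_le_of_ne hs.2 hsb⟩
  rw [hφ.integral_deriv_eq_sub, ← map_sub, ← hz, hℓ, abs_of_nonneg (sub_nonneg.2 hab),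
    Complex.conj_mul'] at hint
  norm_cast at hint
  rw [Real.norm_of_nonneg (by positivity)] at hint
  rcases (norm_nonneg z).eq_or_lt with h0 | h0
  · rw [← h0]
    rcases hab.eq_or_lt with rfl | hab'
    · simp
    -- When z = 0 it remains to see that D ≥ 0: a negative D would make (a, b) a null set.
    · have hD0 : 0 ≤ D := by
        by_contra hneg
        have : volume (Ioo a b) = 0 := by
          refine measure_mono_null (fun s hs => ?_) (ae_iff.1 hD)
          intro hh
          exact hneg ((norm_nonneg _).trans (hh hs))
        rw [Real.volume_Ioo] at this
        simp at this; linarith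
      exact mul_nonneg hD0 (sub_nonneg.2 hab)
  · refine le_of_mul_le_mul_left ?_ h0
    nlinarith

theorem norm_mul_sub_mul_le (u₁ u₂ v₁ v₂ : ℂ) :
    ‖u₁ * v₁ - u₂ * v₂‖ ≤ ‖u₁ - u₂‖ * ‖v₁‖ + ‖u₂‖ * ‖v₁ - v₂‖ := by
  have : u₁ * v₁ - u₂ * v₂ = (u₁ - u₂) * v₁ + u₂ * (v₁ - v₂) := by ring
  rw [this, ← norm_mul, ← norm_mul]
  exact norm_add_le _ _

/-- The piecewise linear cutoff equal to `1` on `(-∞, 1]` and to `0` on `[2, ∞)`. -/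
noncomputable def cutoff (s : ℝ) : ℝ := max 0 (min 1 (2 - s))

theorem cutoff_nonneg (s : ℝ) : 0 ≤ cutoff s := le_max_left _ _

theorem cutoff_le_one (s : ℝ) : cutoff s ≤ 1 := max_le zero_le_one (min_le_left _ _)

theorem cutoff_of_le {s : ℝ} (h : s ≤ 1) : cutoff s = 1 := by
  rw [cutoff, min_eq_left (by linarith), max_eq_right zero_le_one]

theorem cutoff_of_ge {s : ℝ} (h : 2 ≤ s) : cutoff s = 0 := by
  rw [cutoff, max_eq_left]
  exact (min_le_right _ _).trans (by linarith)

theorem abs_cutoff_sub_le (s t : ℝ) : |cutoff s - cutoff t| ≤ |s - t| := by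
  refine (abs_max_sub_max_le_max _ _ _ _).trans (max_le (by simp) ?_)
  refine (abs_min_sub_min_le_max _ _ _ _).trans (max_le (by simp) ?_)
  rw [show 2 - s - (2 - t) = -(s - t) by ring, abs_neg]

/-- The tent-like function supported on `a ≤ |t| ≤ 4 * a`. -/
noncomputable def annulus (a t : ℝ) : ℝ := cutoff (|t| / (2 * a)) - cutoff (|t| / a)

theorem annulus_neg (a t : ℝ) : annulus a (-t) = annulus a t := by simp [annulus]

theorem annulus_of_le {a t : ℝ} (ha : 0 < a) (h : |t| ≤ a) : annulus a t = 0 := by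
  rw [annulus, cutoff_of_le, cutoff_of_le, sub_self]
  · rwa [div_le_one ha]
  · rw [div_le_one (by positivity)]; linarith

theorem annulus_of_ge {a t : ℝ} (ha : 0 < a) (h : 4 * a ≤ |t|) : annulus a t = 0 := by
  rw [annulus, cutoff_of_ge, cutoff_of_ge, sub_self]
  · rw [le_div_iff₀ ha]; linarith
  · rw [le_div_iff₀ (by positivity)]; linarith

theorem abs_annulus_le_one (a t : ℝ) : |annulus a t| ≤ 1 :=
  abs_le.2 ⟨by unfold annulus; linarith [cutoff_nonneg (|t| / (2 * a)), cutoff_le_one (|t| / a)],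
    by unfold annulus; linarith [cutoff_le_one (|t| / (2 * a)), cutoff_nonneg (|t| / a)]⟩

theorem abs_annulus_sub_le {a : ℝ} (ha : 0 < a) (s t : ℝ) :
    |annulus a s - annulus a t| ≤ 2 / a * |s - t| := by
  have h1 := abs_cutoff_sub_le (|s| / (2 * a)) (|t| / (2 * a))
  have h2 := abs_cutoff_sub_le (|s| / a) (|t| / a)
  rw [← sub_div, abs_div (|s| - |t|), abs_of_pos (show 0 < 2 * a by positivity)] at h1
  rw [← sub_div, abs_div (|s| - |t|), abs_of_pos ha] at h2
  have h3 := abs_abs_sub_abs_le s t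
  have e1 : |(|s| - |t|)| / (2 * a) ≤ |s - t| / a := by
    gcongr; linarith
  have e2 : |(|s| - |t|)| / a ≤ |s - t| / a := by gcongr
  have e : annulus a s - annulus a t = (cutoff (|s| / (2 * a)) - cutoff (|t| / (2 * a)))
      - (cutoff (|s| / a) - cutoff (|t| / a)) := by unfold annulus; ring
  rw [e]
  refine (abs_sub _ _).trans ?_
  have : 2 / a * |s - t| = |s - t| / a + |s - t| / a := by ring
  linarith

theorem norm_mul_annulus_sub_le {F : ℝ → ℂ} {a H D : ℝ} (ha : 0 < a)
    (hH : ∀ t, a ≤ t → t ≤ 4 * a → ‖F t‖ ≤ H)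
    (hD : ∀ x y, a ≤ x → x ≤ y → ‖F x - F y‖ ≤ D * (y - x)) {x y : ℝ} (hx : 0 ≤ x) (hxy : x ≤ y) :
    ‖F x * annulus a x - F y * annulus a y‖ ≤ (D + H * (2 / a)) * (y - x) := by
  have hH0 : 0 ≤ H := (norm_nonneg _).trans (hH a le_rfl (by linarith))
  have hD0 : 0 ≤ D := by
    have := (norm_nonneg _).trans (hD a (a + 1) le_rfl (by linarith))
    linarith
  -- Projecting onto [a, 4a] does not change the product, since the annular factor vanishes outside,
  -- and it keeps F where its bounds hold.
  let p : ℝ → ℝ := fun t => max a (min t (4 * a))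
  have hp : ∀ t, a ≤ p t ∧ p t ≤ 4 * a := fun t =>
    ⟨le_max_left _ _, max_le (by linarith) (min_le_right _ _)⟩
  have hpm : p x ≤ p y := max_le_max le_rfl (min_le_min hxy le_rfl)
  have hpd : p y - p x ≤ y - x := by
    have h1 : |p y - p x| ≤ |y - x| :=
      (abs_max_sub_max_le_max _ _ _ _).trans (max_le (by simp)
        ((abs_min_sub_min_le_max _ _ _ _).trans (max_le le_rfl (by simp))))
    rwa [abs_of_nonneg (sub_nonneg.2 hpm), abs_of_nonneg (sub_nonneg.2 hxy)] at h1
  have hproj : ∀ t, 0 ≤ t → F t * annulus a t = F (p t) * annulus a t := by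
    intro t ht
    rcases le_total t a with h | h
    · rw [annulus_of_le ha (by rwa [abs_of_nonneg ht])]; simp
    · rcases le_total (4 * a) t with h' | h'
      · rw [annulus_of_ge ha (by rwa [abs_of_nonneg ht])]; simp
      · simp only [p, min_eq_left h', max_eq_right h]
  rw [hproj x hx, hproj y (hx.trans hxy)]
  refine (norm_mul_sub_mul_le _ _ _ _).trans ?_
  have h1 : ‖F (p x) - F (p y)‖ ≤ D * (y - x) :=
    (hD _ _ (hp x).1 hpm).trans (by gcongr)
  have h2 : ‖(annulus a x : ℂ)‖ ≤ 1 := by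
    rw [Complex.norm_real]; exact abs_annulus_le_one a x
  have h3 : ‖(annulus a x : ℂ) - annulus a y‖ ≤ 2 / a * (y - x) := by
    rw [← Complex.ofReal_sub, Complex.norm_real, ← abs_of_nonneg (sub_nonneg.2 hxy), abs_sub_comm y x]
    exact abs_annulus_sub_le ha x y
  calc _ ≤ D * (y - x) * 1 + H * (2 / a * (y - x)) := by
        gcongr
        exact hH _ (hp y).1 (hp y).2
    _ = _ := by ring

/-- The product has Lipschitz constant D + 2H/a and support of length 8a, so HKL = 8HDa + 16H². F
need not be regular at 0: the two half-lines are glued where the annular factor vanishes. -/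
theorem RepBound.mul_annulus {F : ℝ → ℂ} {a H D : ℝ} (ha : 0 < a)
    (hH : ∀ t, a ≤ |t| → |t| ≤ 4 * a → ‖F t‖ ≤ H)
    (hD : ∀ x y, x ≤ y → (a ≤ x ∨ y ≤ -a) → ‖F x - F y‖ ≤ D * (y - x)) :
    RepBound (fun t => F t * annulus a t) (ENNReal.ofReal (28 * (H + √(H * D * a)))) := by
  have hH0 : 0 ≤ H := (norm_nonneg _).trans (hH a (le_abs_self a) (by rw [abs_of_pos ha]; linarith))
  have hD0 : 0 ≤ D := by
    have := (norm_nonneg _).trans (hD a (a + 1) (by linarith) (Or.inl le_rfl))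
    linarith
  set K := D + H * (2 / a) with hK
  have hK0 : 0 ≤ K := by positivity
  have hpos : ∀ x y, 0 ≤ x → x ≤ y →
      ‖F x * annulus a x - F y * annulus a y‖ ≤ K * (y - x) := fun x y hx hxy =>
    norm_mul_annulus_sub_le ha (fun t h1 h2 => hH t (h1.trans (le_abs_self _))
      (by rwa [abs_of_nonneg (ha.le.trans h1)])) (fun x y h1 h2 => hD x y h2 (Or.inl h1)) hx hxy
  have hneg : ∀ x y, x ≤ y → y ≤ 0 →
      ‖F x * annulus a x - F y * annulus a y‖ ≤ K * (y - x) := by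
    intro x y hxy hy
    have := norm_mul_annulus_sub_le (F := fun t => F (-t)) (H := H) (D := D) (x := -y) (y := -x) ha
      (fun t h1 h2 => hH (-t) (by rw [abs_neg]; exact h1.trans (le_abs_self _))
        (by rwa [abs_neg, abs_of_nonneg (ha.le.trans h1)]))
      (fun x y h1 h2 => by
        have := hD (-y) (-x) (by linarith) (Or.inr (by linarith))
        rw [norm_sub_rev]
        convert this using 2
        ring) (by linarith) (by linarith)
    simp only [neg_neg, annulus_neg] at this
    rw [norm_sub_rev]
    convert this using 2
    ring
  have hle : ∀ x y, x ≤ y → ‖F x * annulus a x - F y * annulus a y‖ ≤ K * (y - x) := by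
    intro x y hxy
    rcases le_total 0 x with h | h
    · exact hpos x y h hxy
    rcases le_total y 0 with h' | h'
    · exact hneg x y hxy h'
    · calc _ ≤ _ := norm_sub_le_norm_sub_add_norm_sub _ (F 0 * annulus a 0) _
        _ ≤ K * (0 - x) + K * (y - 0) := add_le_add (hneg x 0 h le_rfl) (hpos 0 y le_rfl h')
        _ = _ := by ring
  refine (RepBound.of_lipschitz (H := H) (K := K) (a := -(4 * a)) (b := 4 * a) ?_ ?_ ?_
    (by linarith)).mono (ENNReal.ofReal_le_ofReal ?_)
  · intro t
    rcases le_total |t| a with h | h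
    · rw [annulus_of_le ha h]; simpa using hH0
    rcases le_total (4 * a) |t| with h' | h'
    · rw [annulus_of_ge ha h']; simpa using hH0
    rw [norm_mul, Complex.norm_real]
    exact (mul_le_mul (hH t h h') (abs_annulus_le_one a t) (abs_nonneg _) hH0).trans
      (mul_one _).le
  · intro x y
    rcases le_total x y with h | h
    · rw [abs_sub_comm, abs_of_nonneg (sub_nonneg.2 h)]; exact hle x y h
    · rw [norm_sub_rev, abs_of_nonneg (sub_nonneg.2 h)]; exact hle y x h
  · intro t ht
    rw [annulus_of_ge ha]
    · simp
    · by_contra! hc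
      exact ht (abs_le.1 hc.le)
  · have e : H * K * (4 * a - -(4 * a)) = 8 * (H * D * a) + 16 * H ^ 2 := by
      rw [hK]; field_simp; ring
    rw [e]
    have h1 : √(8 * (H * D * a) + 16 * H ^ 2) ≤ 4 * (H + √(H * D * a)) := by
      apply Real.sqrt_le_iff.2 ⟨by positivity, ?_⟩
      have : √(H * D * a) ^ 2 = H * D * a := Real.sq_sqrt (by positivity)
      nlinarith [mul_nonneg hH0 (Real.sqrt_nonneg (H * D * a))]
    linarith

/-- The same estimate with bounds in `[0, ∞]`. -/
theorem RepBound.mul_annulus_ennreal {F : ℝ → ℂ} {a : ℝ} {H D : ℝ≥0∞} (ha : 0 < a)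
    (hHt : H ≠ ∞) (hDt : D ≠ ∞)
    (hH : ∀ t, a ≤ |t| → |t| ≤ 4 * a → ‖F t‖ₑ ≤ H)
    (hD : ∀ x y, x ≤ y → (a ≤ x ∨ y ≤ -a) → ‖F x - F y‖ₑ ≤ D * ENNReal.ofReal (y - x)) :
    RepBound (fun t => F t * annulus a t)
      (28 * (H + (H * D * ENNReal.ofReal a) ^ (1 / 2 : ℝ))) := by
  refine (RepBound.mul_annulus (H := H.toReal) (D := D.toReal) ha ?_ ?_).mono (le_of_eq ?_)
  · intro t h1 h2
    rw [← toReal_enorm]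
    exact ENNReal.toReal_mono hHt (hH t h1 h2)
  · intro x y hxy h
    have := ENNReal.toReal_mono (ENNReal.mul_ne_top hDt ENNReal.ofReal_ne_top) (hD x y hxy h)
    rwa [toReal_enorm, ENNReal.toReal_mul, ENNReal.toReal_ofReal (sub_nonneg.2 hxy)] at this
  · rw [ENNReal.ofReal_mul (by norm_num), ENNReal.ofReal_add (by positivity) (by positivity),
      ENNReal.ofReal_toReal hHt, Real.sqrt_eq_rpow, ← ENNReal.ofReal_rpow_of_nonneg (by positivity)
      (by norm_num), ENNReal.ofReal_mul (by positivity), ENNReal.ofReal_mul (by positivity),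
      ENNReal.ofReal_toReal hHt, ENNReal.ofReal_toReal hDt]
    norm_num

theorem RepBound.const_mul_cutoff (z : ℂ) :
    RepBound (fun t : ℝ => z * (cutoff |t| : ℂ)) (14 * ‖z‖ₑ) := by
  refine (RepBound.of_lipschitz (H := ‖z‖) (K := ‖z‖) (a := -2) (b := 2) ?_ ?_ ?_
    (by norm_num)).mono (le_of_eq ?_)
  · intro t
    rw [norm_mul, Complex.norm_real, Real.norm_of_nonneg (cutoff_nonneg _)]
    exact mul_le_of_le_one_right (norm_nonneg _) (cutoff_le_one _)
  · intro x y
    rw [← mul_sub, norm_mul, ← Complex.ofReal_sub, Complex.norm_real]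
    gcongr
    exact (abs_cutoff_sub_le _ _).trans (abs_abs_sub_abs_le x y)
  · intro t ht
    rw [cutoff_of_ge]
    · simp
    · by_contra! hc
      exact ht (abs_le.1 hc.le)
  · rw [show ‖z‖ * ‖z‖ * (2 - -2) = (2 * ‖z‖) ^ 2 by ring, Real.sqrt_sq (by positivity),
      ← mul_assoc, ENNReal.ofReal_mul (by norm_num), ofReal_norm]
    norm_num

/-! ### The majorants and the oscillation at the origin -/

theorem f0_anti (f : ℝ → ℂ) {s t : ℝ} (h : |s| ≤ |t|) : f0 f t ≤ f0 f s :=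
  iSup₂_le fun x hx => le_iSup₂ (f := fun (x : ℝ) (_ : |s| ≤ |x|) => ‖f x‖ₑ) x (h.trans hx)

theorem enorm_le_f0 (f : ℝ → ℂ) {s t : ℝ} (h : |t| ≤ |s|) : ‖f s‖ₑ ≤ f0 f t :=
  le_iSup₂ (f := fun (x : ℝ) (_ : |t| ≤ |x|) => ‖f x‖ₑ) s h

theorem f0_ne_top (f : C₀(ℝ, ℂ)) (t : ℝ) : f0 f t ≠ ∞ := by
  obtain ⟨C, hC⟩ : ∃ C, ∀ x, ‖f x‖ ≤ C := ⟨‖f.toBCF‖, fun x => f.toBCF.norm_coe_le_norm x⟩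
  refine ne_top_of_le_ne_top (ENNReal.ofReal_ne_top (r := C)) (iSup₂_le fun x _ => ?_)
  rw [← ofReal_norm]
  exact ENNReal.ofReal_le_ofReal (hC x)

theorem f1_anti (f : ℝ → ℂ) {s t : ℝ} (h : |s| ≤ |t|) : f1 f t ≤ f1 f s :=
  essSup_mono_measure' (Measure.restrict_mono (fun _ hx => h.trans hx) le_rfl)

theorem f1_ne_top {f : ℝ → ℂ} {t : ℝ} (h : DerivBoundedOutside f |t|) : f1 f t ≠ ∞ := by
  obtain ⟨M, hM⟩ := h
  refine ne_top_of_le_ne_top (ENNReal.ofReal_ne_top (r := M)) (essSup_le_of_ae_le _ ?_)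
  rw [Filter.EventuallyLE, ae_restrict_iff' (measurableSet_le measurable_const (by fun_prop))]
  filter_upwards [hM] with s hs h'
  rw [← ofReal_norm]
  exact ENNReal.ofReal_le_ofReal (hs h')

theorem ae_norm_deriv_le_f1 {f : ℝ → ℂ} {t : ℝ} (h : f1 f t ≠ ∞) :
    ∀ᵐ s : ℝ, |t| ≤ |s| → ‖deriv f s‖ ≤ (f1 f t).toReal := by
  have := ae_le_essSup (μ := volume.restrict {s : ℝ | |t| ≤ |s|}) (f := fun s : ℝ => ‖deriv f s‖ₑ)
  rw [ae_restrict_iff' (measurableSet_le measurable_const (by fun_prop))] at this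
  filter_upwards [this] with s hs h'
  rw [← toReal_enorm]
  exact ENNReal.toReal_mono h (hs h')

theorem enorm_sub_le_f1 {f : ℝ → ℂ} (hf : LocallyACOffZero f) {a x y : ℝ} (ha : 0 < a)
    (hxy : x ≤ y) (h : a ≤ x ∨ y ≤ -a) :
    ‖f x - f y‖ₑ ≤ f1 f a * ENNReal.ofReal (y - x) := by
  rcases hxy.eq_or_lt with rfl | hlt
  · simp
  by_cases ht : f1 f a = ∞
  · rw [ht, ENNReal.top_mul (by simpa using hlt)]; exact le_top
  have h0 : (0 : ℝ) ∉ uIcc x y := by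
    rw [uIcc_of_le hxy]
    rintro ⟨h1, h2⟩
    rcases h with h | h <;> linarith
  have := norm_sub_le_of_ae_norm_deriv_le (D := (f1 f a).toReal) hxy (hf x y h0) (by
    filter_upwards [ae_norm_deriv_le_f1 ht] with s hs hmem
    refine hs ?_
    rw [abs_of_pos ha]
    rcases h with h | h
    · exact (h.trans hmem.1.le).trans (le_abs_self s)
    · exact (by linarith [hmem.2] : a ≤ -s).trans (neg_le_abs s))
  rw [norm_sub_rev] at this
  rw [← ofReal_norm, ← ENNReal.ofReal_toReal ht, ← ENNReal.ofReal_mul ENNReal.toReal_nonneg]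
  exact ENNReal.ofReal_le_ofReal this

/-- The integral of the decreasing majorant of `|f'|` over `(0, t)`. -/
noncomputable def intF1 (f : ℝ → ℂ) (t : ℝ) : ℝ≥0∞ := ∫⁻ s in Ioo (0 : ℝ) t, f1 f s

theorem intF1_mono (f : ℝ → ℂ) {s t : ℝ} (h : s ≤ t) : intF1 f s ≤ intF1 f t :=
  lintegral_mono_set (Ioo_subset_Ioo_right h)

theorem f1_mul_le_setLIntegral (f : ℝ → ℂ) {a b : ℝ} (ha : 0 ≤ a) :
    f1 f b * ENNReal.ofReal (b - a) ≤ ∫⁻ s in Ioo a b, f1 f s := by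
  rw [← Real.volume_Ioo, ← setLIntegral_const]
  refine setLIntegral_mono' measurableSet_Ioo fun s hs => f1_anti f ?_
  rw [abs_of_nonneg (ha.trans hs.1.le), abs_of_nonneg (ha.trans (hs.1.trans hs.2).le)]
  exact hs.2.le

theorem f1_mul_le_intF1 (f : ℝ → ℂ) (b : ℝ) : f1 f b * ENNReal.ofReal b ≤ intF1 f b := by
  simpa [intF1] using f1_mul_le_setLIntegral f (b := b) le_rfl

theorem intF1_add_le (f : ℝ → ℂ) {a b : ℝ} (ha : 0 ≤ a) (hab : a ≤ b) :
    (∫⁻ s in Ioo a b, f1 f s) + intF1 f a ≤ intF1 f b := by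
  rw [intF1, intF1, add_comm, ← lintegral_union measurableSet_Ioo]
  · exact lintegral_mono_set (union_subset (Ioo_subset_Ioo_right hab) (Ioo_subset_Ioo_left ha))
  · exact Set.disjoint_left.2 fun s h1 h2 => absurd h1.2 (not_lt.2 h2.1.le)

/-- f₁ is decreasing, so f₁(|s|/2)·|s|/2 is at most twice its integral over (|s|/4, |s|/2). The
additive form telescopes under halving without subtraction in [0, ∞]. -/
theorem enorm_sub_half_add_le {f : ℝ → ℂ} (hf : LocallyACOffZero f) {s : ℝ} (hs : s ≠ 0) :
    ‖f s - f (s / 2)‖ₑ + 2 * intF1 f (|s| / 4) ≤ 2 * intF1 f (|s| / 2) := by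
  have hr : 0 < |s| := abs_pos.2 hs
  have h1 : ‖f s - f (s / 2)‖ₑ ≤ f1 f (|s| / 2) * ENNReal.ofReal (|s| / 2) := by
    rcases lt_or_gt_of_ne hs with h | h
    · rw [abs_of_neg h]
      have := enorm_sub_le_f1 hf (a := -s / 2) (x := s) (y := s / 2) (by linarith) (by linarith)
        (Or.inr (by linarith))
      rwa [show s / 2 - s = -s / 2 by ring] at this
    · rw [abs_of_pos h]
      have := enorm_sub_le_f1 hf (a := s / 2) (x := s / 2) (y := s) (by linarith) (by linarith)
        (Or.inl le_rfl)
      rw [← enorm_neg, neg_sub]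
      rwa [show s - s / 2 = s / 2 by ring] at this
  have h2 := f1_mul_le_setLIntegral f (a := |s| / 4) (b := |s| / 2) (by positivity)
  have h3 := intF1_add_le f (a := |s| / 4) (b := |s| / 2) (by positivity) (by linarith)
  have e : ENNReal.ofReal (|s| / 2) = 2 * ENNReal.ofReal (|s| / 2 - |s| / 4) := by
    rw [show |s| / 2 = 2 * (|s| / 2 - |s| / 4) by ring, ENNReal.ofReal_mul (by norm_num)]
    norm_num
    ring_nf
  calc _ ≤ 2 * (f1 f (|s| / 2) * ENNReal.ofReal (|s| / 2 - |s| / 4)) + 2 * intF1 f (|s| / 4) := by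
        gcongr
        refine h1.trans (le_of_eq ?_)
        rw [e]; ring
    _ ≤ 2 * ((∫⁻ s in Ioo (|s| / 4) (|s| / 2), f1 f s) + intF1 f (|s| / 4)) := by
        rw [mul_add]; gcongr
    _ ≤ _ := by gcongr

theorem enorm_sub_div_two_pow_add_le {f : ℝ → ℂ} (hf : LocallyACOffZero f) {s : ℝ} (hs : s ≠ 0)
    (n : ℕ) :
    ‖f s - f (s / 2 ^ n)‖ₑ + 2 * intF1 f (|s| / 2 ^ n / 2) ≤ 2 * intF1 f (|s| / 2) := by
  induction n with
  | zero => simp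
  | succ n ih =>
    have h1 := enorm_sub_half_add_le hf (s := s / 2 ^ n) (by positivity)
    rw [abs_div, abs_of_pos (show (0 : ℝ) < 2 ^ n by positivity)] at h1
    have e1 : s / 2 ^ (n + 1) = s / 2 ^ n / 2 := by rw [pow_succ]; field_simp
    have e2 : |s| / 2 ^ (n + 1) / 2 = |s| / 2 ^ n / 4 := by rw [pow_succ]; field_simp; norm_num
    rw [e1, e2]
    calc _ ≤ (‖f s - f (s / 2 ^ n)‖ₑ + ‖f (s / 2 ^ n) - f (s / 2 ^ n / 2)‖ₑ)
          + 2 * intF1 f (|s| / 2 ^ n / 4) := by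
          gcongr
          rw [← sub_add_sub_cancel (f s) (f (s / 2 ^ n))]
          exact enorm_add_le _ _
      _ = ‖f s - f (s / 2 ^ n)‖ₑ + (‖f (s / 2 ^ n) - f (s / 2 ^ n / 2)‖ₑ
          + 2 * intF1 f (|s| / 2 ^ n / 4)) := add_assoc _ _ _
      _ ≤ _ := by gcongr
      _ ≤ _ := ih

theorem enorm_sub_zero_le {f : ℝ → ℂ} (hf : LocallyACOffZero f) (hc : Continuous f) (s : ℝ) :
    ‖f s - f 0‖ₑ ≤ 2 * intF1 f (|s| / 2) := by
  rcases eq_or_ne s 0 with rfl | hs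
  · simp
  have h1 : Filter.Tendsto (fun n : ℕ => s / 2 ^ n) Filter.atTop (nhds 0) := by
    have := (tendsto_pow_atTop_nhds_zero_of_lt_one (r := (1 / 2 : ℝ)) (by norm_num)
      (by norm_num)).const_mul s
    simpa [div_eq_mul_inv] using this
  have h2 : Filter.Tendsto (fun n : ℕ => ‖f s - f (s / 2 ^ n)‖ₑ) Filter.atTop
      (nhds ‖f s - f 0‖ₑ) := (((hc.tendsto 0).comp h1).const_sub (f s)).enorm
  exact le_of_tendsto' h2 fun n => le_self_add.trans (enorm_sub_div_two_pow_add_le hf hs n)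

theorem measurable_f1 (f : ℝ → ℂ) : Measurable (f1 f) := by
  have h : Antitone fun t : ℝ =>
      essSup (fun s : ℝ => ‖deriv f s‖ₑ) (volume.restrict {s : ℝ | t ≤ |s|}) := fun s t hst =>
    essSup_mono_measure' (Measure.restrict_mono (fun _ hx => hst.trans hx) le_rfl)
  exact h.measurable.comp measurable_id.abs

/-! ### Comparison of dyadic sums with the integrals -/

/-- At most ⌊log₂(1/t)⌋ + 1 ≤ log₂(2/t) indices count, and ln 2 ≥ 1/2. -/
theorem tsum_indicator_le {t : ℝ} (h0 : 0 < t) (h1 : t < 1) :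
    ∑' n : ℕ, (Ioo (0 : ℝ) ((1 / 2) ^ n)).indicator (fun _ => (1 : ℝ≥0∞)) t
      ≤ 2 * ENNReal.ofReal (Real.log (2 / t)) := by
  set N := ⌊Real.logb 2 (1 / t)⌋₊ with hN
  have hlog0 : 0 ≤ Real.logb 2 (1 / t) :=
    Real.logb_nonneg (by norm_num) (by rw [le_div_iff₀ h0]; linarith)
  have hz : ∀ n ∉ Finset.range (N + 1),
      (Ioo (0 : ℝ) ((1 / 2) ^ n)).indicator (fun _ => (1 : ℝ≥0∞)) t = 0 := by
    intro n hn
    apply indicator_of_notMem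
    rintro ⟨-, h2⟩
    rw [Finset.mem_range, not_lt] at hn
    have h3 : Real.logb 2 (1 / t) < n :=
      (Nat.lt_floor_add_one _).trans_le (by exact_mod_cast hn)
    rw [Real.logb_lt_iff_lt_rpow (by norm_num) (by positivity), Real.rpow_natCast,
      div_lt_iff₀ h0] at h3
    have : (2 : ℝ) ^ n * (1 / 2) ^ n = 1 := by rw [← mul_pow]; norm_num
    have h5 : (0 : ℝ) < 2 ^ n := by positivity
    nlinarith
  rw [tsum_eq_sum hz]
  calc _ ≤ ∑ n ∈ Finset.range (N + 1), (1 : ℝ≥0∞) :=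
        Finset.sum_le_sum fun n _ => indicator_le_self' (fun _ _ => zero_le) t
    _ = ENNReal.ofReal (N + 1) := by
        rw [Finset.sum_const, Finset.card_range, nsmul_one, ENNReal.ofReal_add (by positivity)
          zero_le_one]
        simp
    _ ≤ ENNReal.ofReal (2 * Real.log (2 / t)) := by
        apply ENNReal.ofReal_le_ofReal
        have h4 : (N : ℝ) ≤ Real.logb 2 (1 / t) := Nat.floor_le hlog0
        have e : Real.logb 2 (1 / t) + 1 = Real.log (2 / t) / Real.log 2 := by
          rw [Real.logb, Real.log_div (by norm_num) h0.ne', Real.log_div (by norm_num) h0.ne',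
            Real.log_one, zero_sub]
          have := Real.log_pos (show (1 : ℝ) < 2 by norm_num)
          field_simp; ring
        have h6 : 0 ≤ Real.log (2 / t) := Real.log_nonneg (by rw [le_div_iff₀ h0]; linarith)
        have h7 := Real.log_two_gt_d9
        have : Real.log (2 / t) / Real.log 2 ≤ 2 * Real.log (2 / t) := by
          rw [div_le_iff₀ (by linarith)]
          nlinarith
        linarith
    _ = _ := by rw [ENNReal.ofReal_mul (by norm_num)]; norm_num

theorem tsum_intF1_le (f : ℝ → ℂ) : ∑' n : ℕ, intF1 f ((1 / 2) ^ n) ≤ 2 * A1 f := by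
  have e : ∀ n : ℕ, intF1 f ((1 / 2) ^ n) = ∫⁻ t in Ioo (0 : ℝ) 1,
      f1 f t * (Ioo (0 : ℝ) ((1 / 2) ^ n)).indicator (fun _ => (1 : ℝ≥0∞)) t := by
    intro n
    have hsub : Ioo (0 : ℝ) ((1 / 2) ^ n) ⊆ Ioo 0 1 :=
      Ioo_subset_Ioo_right (pow_le_one₀ (by norm_num) (by norm_num))
    have : (fun t => f1 f t * (Ioo (0 : ℝ) ((1 / 2) ^ n)).indicator (fun _ => (1 : ℝ≥0∞)) t)
        = (Ioo (0 : ℝ) ((1 / 2) ^ n)).indicator (f1 f) := by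
      ext t
      by_cases ht : t ∈ Ioo (0 : ℝ) ((1 / 2) ^ n)
      · rw [indicator_of_mem ht, indicator_of_mem ht, mul_one]
      · rw [indicator_of_notMem ht, indicator_of_notMem ht, mul_zero]
    rw [this, setLIntegral_indicator measurableSet_Ioo, inter_eq_left.2 hsub, intF1]
  simp only [e]
  rw [← lintegral_tsum]
  · rw [A1, ← lintegral_const_mul' _ _ (by norm_num)]
    refine setLIntegral_mono' measurableSet_Ioo fun t ht => ?_
    rw [ENNReal.tsum_mul_left, mul_left_comm]
    gcongr
    exact tsum_indicator_le ht.1 ht.2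
  · intro n
    exact ((measurable_f1 f).mul (measurable_const.indicator measurableSet_Ioo)).aemeasurable

/-- On (2ⁿ, 2ⁿ⁺¹) the integrand is at least v n / 2ⁿ⁺¹ and the length is 2ⁿ, so each block
contributes at least half of v n. -/
theorem tsum_dyadic_le {v : ℕ → ℝ≥0∞} {w : ℝ → ℝ≥0∞}
    (h : ∀ n, ∀ t ∈ Ioo ((2 : ℝ) ^ n) (2 ^ (n + 1)), v n ≤ w t) :
    ∑' n, v n ≤ 2 * ∫⁻ t in Ioi (1 : ℝ), w t / ENNReal.ofReal t := by
  have hd : Pairwise (Function.onFun Disjoint fun n : ℕ => Ioo ((2 : ℝ) ^ n) (2 ^ (n + 1))) := by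
    refine (pairwise_disjoint_on _).2 fun m n hmn => Set.disjoint_left.2 fun t h1 h2 => ?_
    have : (2 : ℝ) ^ (m + 1) ≤ 2 ^ n := pow_le_pow_right₀ (by norm_num) hmn
    linarith [h1.2, h2.1]
  calc ∑' n, v n ≤ ∑' n : ℕ, 2 * ∫⁻ t in Ioo ((2 : ℝ) ^ n) (2 ^ (n + 1)), w t / ENNReal.ofReal t := by
        refine ENNReal.tsum_le_tsum fun n => ?_
        have hp : (0 : ℝ) < 2 ^ n := by positivity
        have h1 : v n / ENNReal.ofReal (2 ^ (n + 1)) * ENNReal.ofReal (2 ^ n)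
            ≤ ∫⁻ t in Ioo ((2 : ℝ) ^ n) (2 ^ (n + 1)), w t / ENNReal.ofReal t := by
          have e : (2 : ℝ) ^ n = 2 ^ (n + 1) - 2 ^ n := by rw [pow_succ]; ring
          rw [show ENNReal.ofReal (2 ^ n) = volume (Ioo ((2 : ℝ) ^ n) (2 ^ (n + 1))) by
            rw [Real.volume_Ioo, ← e], ← setLIntegral_const]
          refine setLIntegral_mono' measurableSet_Ioo fun t ht => ?_
          exact ENNReal.div_le_div (h n t ht) (ENNReal.ofReal_le_ofReal ht.2.le)
        refine le_trans (le_of_eq ?_) (mul_le_mul_right h1 2)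
        rw [pow_succ (2 : ℝ), ENNReal.ofReal_mul hp.le, ← mul_assoc, mul_div_assoc', div_eq_mul_inv,
          ENNReal.mul_inv (Or.inr (by simp)) (Or.inr (by simp))]
        have hq : ENNReal.ofReal ((2 : ℝ) ^ n) ≠ 0 := by simp
        have e2 : ENNReal.ofReal (2 : ℝ) = 2 := by norm_num
        rw [e2]
        calc v n = v n * (2 * 2⁻¹) * ((ENNReal.ofReal ((2 : ℝ) ^ n))⁻¹ * ENNReal.ofReal ((2 : ℝ) ^ n)) := by
              rw [ENNReal.mul_inv_cancel (by norm_num) (by norm_num),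
                ENNReal.inv_mul_cancel hq ENNReal.ofReal_ne_top]; simp
          _ = _ := by ring
    _ = 2 * ∫⁻ t in ⋃ n : ℕ, Ioo ((2 : ℝ) ^ n) (2 ^ (n + 1)), w t / ENNReal.ofReal t := by
        rw [ENNReal.tsum_mul_left, lintegral_iUnion (fun n => measurableSet_Ioo) hd]
    _ ≤ _ := by
        gcongr
        refine iUnion_subset fun n t ht => ?_
        exact (one_le_pow₀ (by norm_num)).trans_lt ht.1

theorem ennreal_rpow_half_mul_self (x : ℝ≥0∞) : (x * x) ^ (1 / 2 : ℝ) = x := by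
  rw [← sq, ← ENNReal.rpow_natCast, ← ENNReal.rpow_mul]; norm_num

theorem ennreal_rpow_half_le_add (x y : ℝ≥0∞) : (x * y * 2) ^ (1 / 2 : ℝ) ≤ x + y := by
  rw [← ennreal_rpow_half_mul_self (x + y)]
  refine ENNReal.rpow_le_rpow ?_ (by norm_num)
  calc x * y * 2 ≤ x * y * 2 + (x * x + y * y) := le_self_add
    _ = _ := by ring

theorem tsum_f0_le (f : ℝ → ℂ) : ∑' n : ℕ, f0 f (2 ^ (n + 1)) ≤ 2 * A0 f := by
  refine tsum_dyadic_le fun n t ht => f0_anti f ?_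
  have h0 : (0 : ℝ) < 2 ^ n := by positivity
  rw [abs_of_pos (h0.trans ht.1), abs_of_pos (by positivity)]
  exact ht.2.le

/-- For t < 2ⁿ⁺¹ the tail integral contains the block (2ⁿ⁺¹, 2ⁿ⁺²), where f₀f₁ is at least its value
at the right end. Hence the shift by 2; the first two terms are bounded separately. -/
theorem tsum_rpow_half_le (f : ℝ → ℂ) :
    ∑' n : ℕ, (f0 f (2 ^ (n + 2)) * f1 f (2 ^ (n + 2)) * ENNReal.ofReal (2 ^ (n + 2))) ^ (1 / 2 : ℝ)
      ≤ 4 * A01 f := by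
  have h : ∀ n : ℕ, ∀ t ∈ Ioo ((2 : ℝ) ^ n) (2 ^ (n + 1)),
      (f0 f (2 ^ (n + 2)) * f1 f (2 ^ (n + 2)) * ENNReal.ofReal (2 ^ (n + 2))) ^ (1 / 2 : ℝ)
      ≤ 2 * (∫⁻ s in Ioi t, f0 f s * f1 f s) ^ (1 / 2 : ℝ) := by
    intro n t ht
    have h1 : f0 f (2 ^ (n + 2)) * f1 f (2 ^ (n + 2)) * ENNReal.ofReal (2 ^ (n + 1))
        ≤ ∫⁻ s in Ioi t, f0 f s * f1 f s := by
      have e : (2 : ℝ) ^ (n + 1) = 2 ^ (n + 2) - 2 ^ (n + 1) := by ring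
      rw [show ENNReal.ofReal (2 ^ (n + 1)) = volume (Ioo ((2 : ℝ) ^ (n + 1)) (2 ^ (n + 2))) by
        rw [Real.volume_Ioo, ← e], ← setLIntegral_const]
      refine le_trans (setLIntegral_mono' measurableSet_Ioo fun s hs => ?_)
        (lintegral_mono_set (fun s hs => ht.2.trans hs.1 : Ioo ((2 : ℝ) ^ (n + 1)) (2 ^ (n + 2)) ⊆ Ioi t))
      have h0 : (0 : ℝ) < 2 ^ (n + 1) := by positivity
      have : |s| ≤ |(2 : ℝ) ^ (n + 2)| := by
        rw [abs_of_pos (h0.trans hs.1), abs_of_pos (by positivity)]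
        exact hs.2.le
      exact mul_le_mul' (f0_anti f this) (f1_anti f this)
    calc _ ≤ (2 * 2 * ∫⁻ s in Ioi t, f0 f s * f1 f s) ^ (1 / 2 : ℝ) := by
          refine ENNReal.rpow_le_rpow ?_ (by norm_num)
          have e : ENNReal.ofReal (2 ^ (n + 2)) = ENNReal.ofReal (2 ^ (n + 1)) * 2 := by
            rw [pow_succ (2 : ℝ) (n + 1), ENNReal.ofReal_mul (by positivity)]; norm_num
          calc _ = 2 * (f0 f (2 ^ (n + 2)) * f1 f (2 ^ (n + 2)) * ENNReal.ofReal (2 ^ (n + 1))) := by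
                rw [e]; ring
            _ ≤ 2 * ∫⁻ s in Ioi t, f0 f s * f1 f s := by gcongr
            _ ≤ 2 * 2 * ∫⁻ s in Ioi t, f0 f s * f1 f s := by gcongr; norm_num
      _ = _ := by
          rw [ENNReal.mul_rpow_of_nonneg _ _ (by norm_num), ennreal_rpow_half_mul_self]
  refine (tsum_dyadic_le h).trans (le_of_eq ?_)
  rw [A01, ← lintegral_const_mul' _ _ (by norm_num), ← lintegral_const_mul' _ _ (by norm_num)]
  refine lintegral_congr fun t => ?_
  rw [mul_div_assoc', mul_div_assoc', ← mul_assoc]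
  norm_num

/-! ### Assembly of part (a) -/

theorem eventually_cutoff_two_pow_mul_eq_zero {t : ℝ} (ht : t ≠ 0) :
    ∀ᶠ n : ℕ in Filter.atTop, cutoff (2 ^ n * |t|) = 0 := by
  have h1 : Filter.Tendsto (fun n : ℕ => (2 : ℝ) ^ n * |t|) Filter.atTop Filter.atTop :=
    (tendsto_pow_atTop_atTop_of_one_lt (by norm_num)).atTop_mul_const (abs_pos.2 ht)
  filter_upwards [h1.eventually_ge_atTop 2] with n hn using cutoff_of_ge hn

theorem repBound_inner {f : ℝ → ℂ} (hf : LocallyACOffZero f) (hc : Continuous f)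
    (hb : ∀ r : ℝ, 0 < r → DerivBoundedOutside f r) (hA1 : A1 f < ∞) :
    RepBound (fun t => (f t - f 0) * cutoff |t|) (224 * A1 f) := by
  have hS : ∑' n : ℕ, 112 * intF1 f ((1 / 2) ^ n) ≤ 224 * A1 f := by
    rw [ENNReal.tsum_mul_left]
    refine (mul_le_mul_right (tsum_intF1_le f) 112).trans (le_of_eq ?_)
    rw [← mul_assoc]; norm_num
  have hfin : ∀ n : ℕ, intF1 f ((1 / 2) ^ n) ≠ ∞ := fun n =>
    ne_top_of_le_ne_top (ENNReal.mul_ne_top (by norm_num) hA1.ne)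
      ((ENNReal.le_tsum n).trans (tsum_intF1_le f))
  have h0 : RepBound (fun t => (f t - f 0) * ((cutoff |t| : ℂ) - cutoff (2 ^ 0 * |t|))) 0 := by
    simpa using RepBound.zero
  refine (RepBound.of_telescope
    (S := fun n t => (f t - f 0) * ((cutoff |t| : ℂ) - cutoff (2 ^ n * |t|)))
    (c := fun n => 112 * intF1 f ((1 / 2) ^ n)) h0 (fun n => ?_) ?_ fun t => ?_).mono ?_
  · set a : ℝ := (1 / 2) ^ (n + 1) with ha
    have ha0 : 0 < a := by positivity
    have hpow : (2 : ℝ) ^ n * (1 / 2) ^ n = 1 := by rw [← mul_pow]; norm_num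
    have ha2 : (1 / 2 : ℝ) ^ n = 2 * a := by rw [ha, pow_succ]; ring
    have hinv : (2 : ℝ) ^ n = 1 / (2 * a) := by
      rw [← ha2, eq_div_iff (by positivity), hpow]
    have hDt : f1 f a ≠ ∞ := f1_ne_top (hb _ (abs_pos.2 ha0.ne'))
    have key := RepBound.mul_annulus_ennreal (F := fun t => f t - f 0) (a := a)
      (H := 2 * intF1 f ((1 / 2) ^ n)) (D := f1 f a) ha0 (ENNReal.mul_ne_top (by norm_num) (hfin n))
      hDt (fun t _ h2 => (enorm_sub_zero_le hf hc t).trans (by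
        gcongr; exact intF1_mono f (by rw [ha2]; linarith)))
      (fun x y hxy h => by
        rw [sub_sub_sub_cancel_right]
        exact enorm_sub_le_f1 hf ha0 hxy h)
    have e : (fun t => (f t - f 0) * ((annulus a t : ℝ) : ℂ)) = fun t =>
        (f t - f 0) * ((cutoff |t| : ℂ) - cutoff (2 ^ (n + 1) * |t|)) -
        (f t - f 0) * ((cutoff |t| : ℂ) - cutoff (2 ^ n * |t|)) := by
      ext t
      have e1 : |t| / (2 * a) = 2 ^ n * |t| := by rw [hinv]; ring
      have e2 : |t| / a = 2 ^ (n + 1) * |t| := by rw [pow_succ, hinv]; field_simp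
      rw [annulus, e1, e2]
      push_cast; ring
    rw [e] at key
    refine key.mono ?_
    -- Since a f₁(a) is at most the integral of f₁ over (0, a), the square-root term is no larger
    -- than H.
    have h1 : 2 * intF1 f ((1 / 2) ^ n) * f1 f a * ENNReal.ofReal a
        ≤ (2 * intF1 f ((1 / 2) ^ n)) * (2 * intF1 f ((1 / 2) ^ n)) := by
      rw [mul_assoc]
      refine mul_le_mul_right ?_ _
      refine (f1_mul_le_intF1 f a).trans ((intF1_mono f (t := (1 / 2) ^ n) (by rw [ha2]; linarith)).trans ?_)
      exact le_mul_of_one_le_left zero_le (by norm_num)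
    calc _ ≤ 28 * (2 * intF1 f ((1 / 2) ^ n) + (2 * intF1 f ((1 / 2) ^ n))) := by
          gcongr
          exact (ENNReal.rpow_le_rpow h1 (by norm_num)).trans_eq (ennreal_rpow_half_mul_self _)
      _ = _ := by ring
  · exact ne_top_of_le_ne_top (ENNReal.mul_ne_top (by norm_num) hA1.ne) hS
  · rcases eq_or_ne t 0 with rfl | ht
    · simp
    · refine tendsto_const_nhds.congr' ?_
      filter_upwards [eventually_cutoff_two_pow_mul_eq_zero ht] with n hn
      rw [hn]; simp
  · rw [zero_add]; exact hS

theorem repBound_of_A_lt_top (f : C₀(ℝ, ℂ)) (hf : LocallyACOffZero f)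
    (hb : ∀ r : ℝ, 0 < r → DerivBoundedOutside f r) (hA0 : A0 f < ∞) (hA1 : A1 f < ∞)
    (hA01 : A01 f < ∞) : RepBound f (1000 * (A0 f + A1 f + A01 f)) := by
  have hc : Continuous f := f.continuous
  have hG : intF1 f 1 ≤ 2 * A1 f := by
    have := (ENNReal.le_tsum (f := fun n : ℕ => intF1 f ((1 / 2) ^ n)) 0).trans (tsum_intF1_le f)
    simpa using this
  have hf11 : f1 f 1 ≤ 2 * A1 f := by
    refine le_trans ?_ hG
    simpa using f1_mul_le_intF1 f 1
  have hf02 : f0 f 2 ≤ 2 * A0 f := by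
    have := (ENNReal.le_tsum (f := fun n : ℕ => f0 f (2 ^ (n + 1))) 0).trans (tsum_f0_le f)
    simpa using this
  -- The dyadic comparison with A₀ only reaches f₀(2); for 1 ≤ |s| ≤ 2 the value is carried over
  -- from ±2 by the derivative bound f₁(1).
  have hf01 : f0 f 1 ≤ 2 * A0 f + 2 * A1 f := by
    refine iSup₂_le fun s hs => ?_
    rw [abs_one] at hs
    rcases le_total 2 |s| with h | h
    · exact (enorm_le_f0 f (by rwa [abs_two])).trans (hf02.trans le_self_add)
    · have h2 : ∃ r : ℝ, |r| = 2 ∧ ‖f s - f r‖ₑ ≤ f1 f 1 * ENNReal.ofReal (2 - |s|) := by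
        rcases le_total 0 s with h0 | h0
        · rw [abs_of_nonneg h0] at hs h ⊢
          exact ⟨2, abs_two, enorm_sub_le_f1 hf one_pos h (Or.inl hs)⟩
        · rw [abs_of_nonpos h0] at hs h ⊢
          refine ⟨-2, by simp, ?_⟩
          rw [← enorm_neg, neg_sub]
          have := enorm_sub_le_f1 hf one_pos (x := -2) (y := s) (by linarith) (Or.inr (by linarith))
          rwa [show s - -2 = 2 - -s by ring] at this
      obtain ⟨r, hr, hle⟩ := h2
      calc ‖f s‖ₑ = ‖f r + (f s - f r)‖ₑ := by rw [add_sub_cancel]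
        _ ≤ ‖f r‖ₑ + ‖f s - f r‖ₑ := enorm_add_le _ _
        _ ≤ _ := by
          gcongr
          · exact (enorm_le_f0 f (by rw [hr, abs_two])).trans hf02
          · refine hle.trans (le_trans ?_ hf11)
            refine mul_le_of_le_one_right zero_le ?_
            rw [ENNReal.ofReal_le_one]; linarith
  have hfz : ‖f 0‖ₑ ≤ 2 * A0 f + 6 * A1 f := by
    calc ‖f 0‖ₑ = ‖f 1 - (f 1 - f 0)‖ₑ := by rw [sub_sub_cancel]
      _ ≤ ‖f 1‖ₑ + ‖f 1 - f 0‖ₑ := enorm_sub_le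
      _ ≤ (2 * A0 f + 2 * A1 f) + 2 * (2 * A1 f) := by
        gcongr
        · exact (enorm_le_f0 f le_rfl).trans hf01
        · refine (enorm_sub_zero_le hf hc 1).trans ?_
          gcongr
          exact (intF1_mono f (by norm_num)).trans hG
      _ = _ := by ring
  set c : ℕ → ℝ≥0∞ := fun n =>
    28 * (f0 f (2 ^ n) + (f0 f (2 ^ n) * f1 f (2 ^ n) * ENNReal.ofReal (2 ^ n)) ^ (1 / 2 : ℝ)) with hcdef
  have hsum : ∑' n, c n ≤ 28 * (8 * A0 f + 10 * A1 f + 4 * A01 f) := by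
    rw [hcdef, ENNReal.tsum_mul_left]
    refine mul_le_mul_right ?_ 28
    rw [ENNReal.tsum_add, tsum_eq_zero_add' ENNReal.summable (f := fun n : ℕ => f0 f (2 ^ n)),
      tsum_eq_zero_add' ENNReal.summable (f := fun n : ℕ =>
        (f0 f (2 ^ n) * f1 f (2 ^ n) * ENNReal.ofReal (2 ^ n)) ^ (1 / 2 : ℝ)),
      tsum_eq_zero_add' ENNReal.summable (f := fun n : ℕ =>
        (f0 f (2 ^ (n + 1)) * f1 f (2 ^ (n + 1)) * ENNReal.ofReal (2 ^ (n + 1))) ^ (1 / 2 : ℝ))]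
    have t0 : (f0 f (2 ^ 0) * f1 f (2 ^ 0) * ENNReal.ofReal (2 ^ 0)) ^ (1 / 2 : ℝ)
        ≤ 2 * A0 f + 2 * A1 f + 2 * A1 f := by
      refine le_trans ?_ ((ennreal_rpow_half_le_add (f0 f 1) (f1 f 1)).trans (add_le_add hf01 hf11))
      simp only [pow_zero]
      gcongr
      norm_num
    have t1 : (f0 f (2 ^ (0 + 1)) * f1 f (2 ^ (0 + 1)) * ENNReal.ofReal (2 ^ (0 + 1))) ^ (1 / 2 : ℝ)
        ≤ 2 * A0 f + 2 * A1 f := by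
      have hf12 : f1 f 2 ≤ 2 * A1 f := (f1_anti f (by norm_num)).trans hf11
      refine le_trans (le_of_eq ?_) ((ennreal_rpow_half_le_add (f0 f 2) (f1 f 2)).trans
        (add_le_add hf02 hf12))
      norm_num
    calc _ ≤ (2 * A0 f + 2 * A1 f) + 2 * A0 f + ((2 * A0 f + 2 * A1 f + 2 * A1 f)
          + ((2 * A0 f + 2 * A1 f) + 4 * A01 f)) := by
          gcongr
          · simpa using hf01
          · exact tsum_f0_le f
          · exact tsum_rpow_half_le f
      _ = 8 * A0 f + 8 * A1 f + 4 * A01 f := by ring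
      _ ≤ _ := by gcongr; norm_num
  have hAfin : 28 * (8 * A0 f + 10 * A1 f + 4 * A01 f) ≠ ∞ := by finiteness
  -- The central piece is split as f(0) times the cutoff plus f - f(0) times the cutoff.
  have hstart : RepBound (fun t => f t * cutoff (|t| / 2 ^ 0))
      (14 * (2 * A0 f + 6 * A1 f) + 224 * A1 f) := by
    have h1 := (RepBound.const_mul_cutoff (f 0)).add (repBound_inner hf hc hb hA1)
    have e : (fun t => f 0 * (cutoff |t| : ℂ) + (f t - f 0) * (cutoff |t| : ℂ)) =
        fun t => f t * (cutoff (|t| / 2 ^ 0) : ℂ) := by ext t; simp; ring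
    rw [e] at h1
    exact h1.mono (by gcongr)
  refine (RepBound.of_telescope (S := fun n t => f t * cutoff (|t| / 2 ^ n)) (c := c) hstart
    (fun n => ?_) (ne_top_of_le_ne_top hAfin hsum) fun t => ?_).mono ?_
  · have ha0 : (0 : ℝ) < 2 ^ n := by positivity
    have key := RepBound.mul_annulus_ennreal (F := f) (a := 2 ^ n) (H := f0 f (2 ^ n))
      (D := f1 f (2 ^ n)) ha0 (f0_ne_top f _) (f1_ne_top (hb _ (abs_pos.2 ha0.ne')))
      (fun t h1 _ => enorm_le_f0 f (by rwa [abs_of_pos ha0]))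
      (fun x y hxy h => enorm_sub_le_f1 hf ha0 hxy h)
    have e : (fun t => f t * ((annulus (2 ^ n) t : ℝ) : ℂ)) = fun t =>
        f t * (cutoff (|t| / 2 ^ (n + 1)) : ℂ) - f t * (cutoff (|t| / 2 ^ n) : ℂ) := by
      ext t
      rw [annulus, pow_succ' (2 : ℝ)]
      push_cast; ring
    rw [e] at key
    exact key
  · refine tendsto_const_nhds.congr' ?_
    have h1 : Filter.Tendsto (fun n : ℕ => (2 : ℝ) ^ n) Filter.atTop Filter.atTop :=
      tendsto_pow_atTop_atTop_of_one_lt (by norm_num)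
    filter_upwards [h1.eventually_ge_atTop |t|] with n hn
    rw [cutoff_of_le ((div_le_one (by positivity)).2 hn)]
    simp
  · calc _ ≤ 14 * (2 * A0 f + 6 * A1 f) + 224 * A1 f + 28 * (8 * A0 f + 10 * A1 f + 4 * A01 f) := by
          gcongr
      _ = 252 * A0 f + 588 * A1 f + 112 * A01 f := by ring
      _ ≤ 1000 * A0 f + 1000 * A1 f + 1000 * A01 f := by
          gcongr <;> norm_num
      _ = _ := by ring

/-! ### Adaptive blocks for part (b) -/

/-- Each truncation freezes g at the endpoint c and ramps down to 0 over [c, c + 1], so derivative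
bounds beyond b never enter. The difference lives on [a, b + 1], of length at most 2(b - a). -/
theorem RepBound.block {g : ℝ → ℂ} {a b H D : ℝ} (hab : a + 1 ≤ b) (hH : ∀ t, a ≤ t → ‖g t‖ ≤ H)
    (hD : ∀ x y, a ≤ x → x ≤ y → y ≤ b → ‖g x - g y‖ ≤ D * (y - x)) :
    RepBound (fun t => g (min t b) * cutoff (t - b + 1) - g (min t a) * cutoff (t - a + 1))
      (ENNReal.ofReal (7 * √(2 * H * (D + 2 * H) * (2 * (b - a))))) := by
  have hH0 : 0 ≤ H := (norm_nonneg _).trans (hH a le_rfl)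
  have hD0 : 0 ≤ D := by
    have := (norm_nonneg _).trans (hD a (a + 1) le_rfl (by linarith) hab)
    linarith
  let p : ℝ → ℝ := fun t => max a (min t b)
  have hpa : ∀ t, a ≤ p t := fun t => le_max_left _ _
  have hpb : ∀ t, p t ≤ b := fun t => max_le (by linarith) (min_le_right _ _)
  have e : (fun t => g (min t b) * (cutoff (t - b + 1) : ℂ) - g (min t a) * cutoff (t - a + 1))
      = fun t => g (p t) * (cutoff (t - b + 1) : ℂ) - g a * cutoff (t - a + 1) := by
    ext t
    rcases le_total t a with h | h
    · have hb : t ≤ b := by linarith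
      simp only [p, min_eq_left h, min_eq_left hb, max_eq_left h]
      rw [cutoff_of_le (by linarith), cutoff_of_le (by linarith)]
      simp
    · simp only [p, min_eq_right h]
      rw [max_eq_right (le_min h (by linarith))]
  rw [e]
  have hcut : ∀ x y c : ℝ, ‖(cutoff (x - c + 1) : ℂ) - cutoff (y - c + 1)‖ ≤ |x - y| := by
    intro x y c
    rw [← Complex.ofReal_sub, Complex.norm_real]
    refine (abs_cutoff_sub_le _ _).trans (le_of_eq ?_)
    congr 1; ring
  have hcut1 : ∀ s : ℝ, ‖(cutoff s : ℂ)‖ ≤ 1 := fun s => by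
    rw [Complex.norm_real, Real.norm_of_nonneg (cutoff_nonneg s)]; exact cutoff_le_one s
  have hgp : ∀ x y, ‖g (p x) - g (p y)‖ ≤ D * |x - y| := by
    intro x y
    wlog hxy : x ≤ y generalizing x y
    · rw [norm_sub_rev, abs_sub_comm]; exact this y x (le_of_not_ge hxy)
    have hm : p x ≤ p y := max_le_max le_rfl (min_le_min hxy le_rfl)
    refine (hD _ _ (hpa x) hm (hpb y)).trans ?_
    gcongr
    rw [← abs_of_nonneg (sub_nonneg.2 hm), abs_sub_comm]
    exact (abs_max_sub_max_le_max _ _ _ _).trans (max_le (by simp)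
        ((abs_min_sub_min_le_max _ _ _ _).trans (max_le le_rfl (by simp))))
  refine (RepBound.of_lipschitz (H := 2 * H) (K := D + 2 * H) (a := a) (b := b + 1) ?_ ?_ ?_
    (by linarith)).mono (ENNReal.ofReal_le_ofReal ?_)
  · intro t
    have h1 : ‖g (p t) * (cutoff (t - b + 1) : ℂ)‖ ≤ H * 1 := by
      rw [norm_mul]; exact mul_le_mul (hH _ (hpa t)) (hcut1 _) (norm_nonneg _) hH0
    have h2 : ‖g a * (cutoff (t - a + 1) : ℂ)‖ ≤ H * 1 := by
      rw [norm_mul]; exact mul_le_mul (hH _ le_rfl) (hcut1 _) (norm_nonneg _) hH0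
    exact (norm_sub_le _ _).trans (by linarith)
  · intro x y
    rw [sub_sub_sub_comm]
    refine (norm_sub_le _ _).trans ?_
    have h1 := norm_mul_sub_mul_le (g (p x)) (g (p y)) (cutoff (x - b + 1)) (cutoff (y - b + 1))
    have h2 : ‖g (p x) - g (p y)‖ * ‖(cutoff (x - b + 1) : ℂ)‖ ≤ D * |x - y| * 1 := by
      have := hgp x y
      have := hcut1 (x - b + 1)
      gcongr
    have h3 : ‖g (p y)‖ * ‖(cutoff (x - b + 1) : ℂ) - cutoff (y - b + 1)‖ ≤ H * |x - y| := by
      have := hH _ (hpa y)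
      have := hcut x y b
      gcongr
    have h4 : ‖g a * (cutoff (x - a + 1) : ℂ) - g a * cutoff (y - a + 1)‖ ≤ H * |x - y| := by
      rw [← mul_sub, norm_mul]
      have := hH _ le_rfl
      have := hcut x y a
      gcongr
    linarith
  · intro t ht
    rcases le_total t a with h | h
    · have hb : t ≤ b := by linarith
      simp only [p, min_eq_left hb, max_eq_left h]
      rw [cutoff_of_le (by linarith), cutoff_of_le (by linarith)]
      simp
    · have h' : b + 1 < t := by
        by_contra! hc
        exact ht ⟨h, hc⟩
      rw [cutoff_of_ge (by linarith), cutoff_of_ge (by linarith)]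
      simp
  · gcongr
    linarith

/-- A subsequence along which an eventually doubling sequence at least doubles at every step,
but has not doubled before the step is complete. -/
theorem exists_doubling_seq {Q : ℕ → ℝ} (hQ : ∀ m, 1 ≤ m → ∃ n, m < n ∧ 2 * Q m ≤ Q n)
    (hpos : ∀ m, 1 ≤ m → 0 < Q m) :
    ∃ m : ℕ → ℕ, m 0 = 1 ∧ ∀ j, 1 ≤ m j ∧ m j < m (j + 1) ∧ 2 * Q (m j) ≤ Q (m (j + 1)) ∧
      ∀ n, m j ≤ n → n < m (j + 1) → Q n < 2 * Q (m j) := by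
  classical
  have step : ∀ m, ∃ n, 1 ≤ m → m < n ∧ 2 * Q m ≤ Q n ∧ ∀ k, m ≤ k → k < n → Q k < 2 * Q m := by
    intro m
    by_cases hm : 1 ≤ m
    · refine ⟨Nat.find (hQ m hm), fun _ => ⟨(Nat.find_spec (hQ m hm)).1,
        (Nat.find_spec (hQ m hm)).2, fun k h1 h2 => ?_⟩⟩
      rcases h1.eq_or_lt with rfl | h1
      · linarith [hpos m hm]
      · have := Nat.find_min (hQ m hm) h2
        push Not at this
        exact this h1
    · exact ⟨0, fun h => absurd h hm⟩
  choose next hnext using step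
  let m : ℕ → ℕ := fun j => Nat.rec 1 (fun _ => next) j
  have h1 : ∀ j, 1 ≤ m j := by
    intro j
    induction j with
    | zero => exact le_rfl
    | succ j ih => exact ih.trans (hnext _ ih).1.le
  exact ⟨m, rfl, fun j => ⟨h1 j, hnext _ (h1 j)⟩⟩

/-- The bound on H leaves Q^{(1-p)/2}, whose exponent is negative because p > 1; this is where δ < 1
is used. -/
theorem sqrt_mul_le_geometric {M F p H Q : ℝ} {j : ℕ} (hM : 0 ≤ M) (hF : 0 < F) (hp : 1 < p)
    (hQ : 2 ^ j * F ≤ Q) (hH : H ≤ (M / Q) ^ p) :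
    √(H * Q) ≤ M ^ (p / 2) * F ^ ((1 - p) / 2) * ((2 : ℝ) ^ ((1 - p) / 2)) ^ j := by
  have hQ0 : 0 < Q := lt_of_lt_of_le (by positivity) hQ
  calc √(H * Q) ≤ √((M / Q) ^ p * Q) := by gcongr
    _ = M ^ (p / 2) * Q ^ ((1 - p) / 2) := by
        rw [Real.sqrt_eq_rpow, Real.div_rpow hM hQ0.le, div_mul_eq_mul_div, mul_div_assoc,
          Real.mul_rpow (by positivity) (by positivity), ← Real.rpow_mul hM]
        nth_rw 1 [← Real.rpow_one Q]
        rw [← Real.rpow_sub hQ0, ← Real.rpow_mul hQ0.le]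
        congr 2 <;> ring
    _ ≤ M ^ (p / 2) * (2 ^ j * F) ^ ((1 - p) / 2) := by
        exact mul_le_mul_of_nonneg_left
          (Real.rpow_le_rpow_of_nonpos (by positivity) hQ (by linarith)) (by positivity)
    _ = _ := by
        rw [Real.mul_rpow (by positivity) hF.le, ← Real.rpow_natCast, ← Real.rpow_natCast,
          ← Real.rpow_mul (by norm_num), ← Real.rpow_mul (by norm_num), mul_comm (j : ℝ)]
        ring

theorem mul_sqrt_le_geometric {M F p H Q : ℝ} {j : ℕ} (hM : 0 ≤ M) (hF : 0 < F) (hp : 1 < p)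
    (hQ : 2 ^ j * F ≤ Q) (hH : H ≤ (M / Q) ^ p) :
    H * √(Q / F) ≤ (M / F) ^ p * ((2 : ℝ) ^ ((1 - p) / 2)) ^ j := by
  have hQ0 : 0 < Q := lt_of_lt_of_le (by positivity) hQ
  have hQF : (2 : ℝ) ^ j ≤ Q / F := by rwa [le_div_iff₀ hF]
  have hQF0 : 0 < Q / F := by positivity
  calc H * √(Q / F) ≤ (M / Q) ^ p * √(Q / F) := by gcongr
    _ = (M / F) ^ p * (Q / F) ^ (1 / 2 - p) := by
        have : M / Q = (M / F) / (Q / F) := by field_simp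
        rw [this, Real.div_rpow (by positivity) hQF0.le, Real.sqrt_eq_rpow, Real.rpow_sub hQF0]
        ring
    _ ≤ (M / F) ^ p * ((2 : ℝ) ^ j) ^ ((1 - p) / 2) := by
        gcongr
        calc (Q / F) ^ (1 / 2 - p) ≤ ((2 : ℝ) ^ j) ^ (1 / 2 - p) :=
              Real.rpow_le_rpow_of_nonpos (by positivity) hQF (by linarith)
          -- The exponent is weakened from 1/2 - p so that both estimates share one ratio.
          _ ≤ _ := Real.rpow_le_rpow_of_exponent_le (one_le_pow₀ (by norm_num)) (by linarith)
    _ = _ := by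
        rw [← Real.rpow_natCast, ← Real.rpow_natCast, ← Real.rpow_mul (by norm_num),
          ← Real.rpow_mul (by norm_num), mul_comm (j : ℝ)]

theorem RepBound.of_doubling {g : ℝ → ℂ} {u F : ℕ → ℝ} {M p : ℝ} (hM : 0 ≤ M) (hp : 1 < p)
    (hF0 : 0 < F 1) (hF : Monotone F) (hg : ∀ t, t ≤ 2 * Real.pi → g t = 0)
    (hu : ∀ k : ℕ, 1 ≤ k → ∀ t, 2 * Real.pi * k ≤ t → ‖g t‖ ≤ u k)
    (hLip : ∀ k : ℕ, 1 ≤ k → ∀ x y, x ≤ y → y ≤ 2 * Real.pi * k + 2 * Real.pi →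
      ‖g x - g y‖ ≤ F k * (y - x))
    (huF : ∀ k : ℕ, 1 ≤ k → u k ≤ (M / (k * F k)) ^ p) :
    RepBound g (ENNReal.ofReal (77 * (1 - (2 : ℝ) ^ ((1 - p) / 2))⁻¹ *
      ((M / F 1) ^ p + M ^ (p / 2) * F 1 ^ ((1 - p) / 2)))) := by
  have hπ := Real.pi_gt_three
  have hπ4 := Real.pi_lt_d2
  set Q : ℕ → ℝ := fun k => k * F k with hQdef
  have hFk : ∀ k, 1 ≤ k → F 1 ≤ F k := fun k hk => hF hk
  have hFpos : ∀ k, 1 ≤ k → 0 < F k := fun k hk => hF0.trans_le (hFk k hk)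
  have hQpos : ∀ k, 1 ≤ k → 0 < Q k := fun k hk =>
    mul_pos (by exact_mod_cast hk) (hFpos k hk)
  obtain ⟨m, hm0, hm⟩ := exists_doubling_seq (Q := Q) (fun k hk => ⟨2 * k, by omega, by
    have h1 : F k ≤ F (2 * k) := hF (by omega)
    simp only [hQdef]
    push_cast
    have : (0 : ℝ) ≤ k := by positivity
    nlinarith⟩) hQpos
  have hQj : ∀ j, 2 ^ j * F 1 ≤ Q (m j) := by
    intro j
    induction j with
    | zero => rw [hm0]; simp [hQdef]
    | succ j ih =>
      have := (hm j).2.2.1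
      rw [pow_succ]
      linarith
  set a : ℕ → ℝ := fun j => 2 * Real.pi * m j with ha
  set r : ℝ := (2 : ℝ) ^ ((1 - p) / 2) with hr
  have hr0 : 0 < r := by positivity
  have hr1 : r < 1 := Real.rpow_lt_one_of_one_lt_of_neg (by norm_num) (by linarith)
  set B : ℝ := (M / F 1) ^ p + M ^ (p / 2) * F 1 ^ ((1 - p) / 2) with hB
  have hB0 : 0 ≤ B := by positivity
  have hpiece : ∀ j, RepBound (fun t => g (min t (a (j + 1))) * (cutoff (t - a (j + 1) + 1) : ℂ)
      - g (min t (a j)) * cutoff (t - a j + 1)) (ENNReal.ofReal (77 * B * r ^ j)) := by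
    intro j
    obtain ⟨h1, h2, -, h4⟩ := hm j
    -- The block ends at 2πn + 2π, where F n is still a valid Lipschitz constant, and n precedes the
    -- doubling, so n F n < 2Q. This is the role of the shift by 2π in A_δ.
    obtain ⟨n, hn⟩ : ∃ n, m (j + 1) = n + 1 := ⟨m (j + 1) - 1, by omega⟩
    have hmn : m j ≤ n := by omega
    have hn1 : 1 ≤ n := h1.trans hmn
    have hmn' : (m j : ℝ) ≤ n := by exact_mod_cast hmn
    have hm1 : (1 : ℝ) ≤ m j := by exact_mod_cast h1
    have ha1 : a (j + 1) = 2 * Real.pi * n + 2 * Real.pi := by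
      simp only [ha, hn]; push_cast; ring
    have hab : a j + 1 ≤ a (j + 1) := by
      rw [ha1]; simp only [ha]; nlinarith
    have key := RepBound.block (g := g) (H := u (m j)) (D := F n) hab
      (hu _ h1) (fun x y _ hxy hy => hLip n hn1 x y hxy (hy.trans_eq ha1))
    refine key.mono (ENNReal.ofReal_le_ofReal ?_)
    set H := u (m j) with hH
    have hH0 : 0 ≤ H := (norm_nonneg _).trans (hu _ h1 _ le_rfl)
    set q := Q (m j) with hq
    have hq0 : 0 < q := hQpos _ h1
    have hnF : n * F n < 2 * q := h4 n hmn (by omega)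
    have hL : a (j + 1) - a j ≤ 2 * Real.pi * n := by
      rw [ha1]; simp only [ha]; nlinarith
    have hL0 : 0 ≤ a (j + 1) - a j := by linarith
    -- The length is at most 2πn and n F n < 2q, which gives 4πq ≤ 13q.
    have hDL : F n * (a (j + 1) - a j) ≤ 13 * q := by
      have := mul_le_mul_of_nonneg_left hL (hFpos n hn1).le
      nlinarith
    have hLq : a (j + 1) - a j ≤ 13 * (q / F 1) := by
      rw [mul_div_assoc', le_div_iff₀ hF0]
      refine le_trans ?_ hDL
      rw [mul_comm]
      exact mul_le_mul_of_nonneg_right (hFk n hn1) hL0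
    have hs1 := sqrt_mul_le_geometric hM hF0 hp (hQj j) (huF _ h1)
    have hs2 := mul_sqrt_le_geometric hM hF0 hp (hQj j) (huF _ h1)
    have hsq : √(2 * H * (F n + 2 * H) * (2 * (a (j + 1) - a j)))
        ≤ 11 * (√(H * q) + H * √(q / F 1)) := by
      apply Real.sqrt_le_iff.2 ⟨by positivity, ?_⟩
      have e1 : √(H * q) ^ 2 = H * q := Real.sq_sqrt (by positivity)
      have e2 : √(q / F 1) ^ 2 = q / F 1 := Real.sq_sqrt (by positivity)
      have e3 : 0 ≤ √(H * q) * (H * √(q / F 1)) := by positivity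
      calc 2 * H * (F n + 2 * H) * (2 * (a (j + 1) - a j))
          = 4 * H * (F n * (a (j + 1) - a j)) + 8 * H ^ 2 * (a (j + 1) - a j) := by ring
        _ ≤ 4 * H * (13 * q) + 8 * H ^ 2 * (13 * (q / F 1)) := by gcongr
        _ ≤ 121 * (H * q) + 121 * (H ^ 2 * (q / F 1)) := by
            have : 0 ≤ H * q := by positivity
            have : 0 ≤ H ^ 2 * (q / F 1) := by positivity
            linarith
        _ = 121 * (√(H * q) ^ 2 + (H * √(q / F 1)) ^ 2) := by rw [mul_pow H, e1, e2]; ring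
        _ ≤ _ := by nlinarith
    calc _ ≤ 7 * (11 * (√(H * q) + H * √(q / F 1))) := by gcongr
      _ ≤ 7 * (11 * (M ^ (p / 2) * F 1 ^ ((1 - p) / 2) * r ^ j + (M / F 1) ^ p * r ^ j)) := by
          gcongr
      _ = _ := by rw [hB]; ring
  have hsum : ∑' j : ℕ, ENNReal.ofReal (77 * B * r ^ j) = ENNReal.ofReal (77 * (1 - r)⁻¹ * B) := by
    rw [← ENNReal.ofReal_tsum_of_nonneg (fun j => by positivity)
      ((summable_geometric_of_lt_one hr0.le hr1).mul_left _), tsum_mul_left,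
      tsum_geometric_of_lt_one hr0.le hr1]
    congr 1; ring
  have h0 : RepBound (fun t => g (min t (a 0)) * (cutoff (t - a 0 + 1) : ℂ)) 0 := by
    have : ∀ t, g (min t (a 0)) = 0 := fun t => hg _ ((min_le_right _ _).trans (by
      simp only [ha, hm0]; simp))
    simpa [this] using RepBound.zero
  have hmj : ∀ j, j ≤ m j := by
    intro j
    induction j with
    | zero => exact Nat.zero_le _
    | succ j ih => have := (hm j).2.1; omega
  refine (RepBound.of_telescope
    (S := fun j t => g (min t (a j)) * (cutoff (t - a j + 1) : ℂ)) h0 hpiece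
    (by rw [hsum]; exact ENNReal.ofReal_ne_top) fun t => ?_).mono (by rw [hsum, zero_add])
  refine tendsto_const_nhds.congr' ?_
  obtain ⟨N, hN⟩ := exists_nat_ge t
  filter_upwards [Filter.eventually_ge_atTop N] with j hj
  have h1 : (N : ℝ) ≤ m j := by exact_mod_cast hj.trans (hmj j)
  have h2 : t ≤ a j := by
    simp only [ha]
    have : (0 : ℝ) ≤ m j := by positivity
    nlinarith
  rw [min_eq_left h2, cutoff_of_le (by linarith)]
  simp

/-! ### Assembly of part (b) -/

theorem fInf_mono (f : ℝ → ℂ) {s t : ℝ} (h : |s| ≤ |t|) : fInf f s ≤ fInf f t :=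
  essSup_mono_measure' (Measure.restrict_mono
    (fun x (hx : 0 < |x| ∧ |x| ≤ |s|) => (⟨hx.1, hx.2.trans h⟩ : 0 < |x| ∧ |x| ≤ |t|)) le_rfl)

theorem ae_norm_deriv_le_fInf {f : ℝ → ℂ} {t : ℝ} (h : fInf f t ≠ ∞) :
    ∀ᵐ s : ℝ, 0 < |s| → |s| ≤ |t| → ‖deriv f s‖ ≤ (fInf f t).toReal := by
  have := ae_le_essSup (μ := volume.restrict {s : ℝ | 0 < |s| ∧ |s| ≤ |t|})
    (f := fun s : ℝ => ‖deriv f s‖ₑ)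
  have hm : MeasurableSet {s : ℝ | 0 < |s| ∧ |s| ≤ |t|} := by
    have h1 : MeasurableSet {s : ℝ | 0 < |s|} := measurableSet_lt measurable_const (by fun_prop)
    have h2 : MeasurableSet {s : ℝ | |s| ≤ |t|} := measurableSet_le (by fun_prop) measurable_const
    exact h1.inter h2
  rw [ae_restrict_iff' hm] at this
  filter_upwards [this] with s hs h1 h2
  rw [← toReal_enorm]
  exact ENNReal.toReal_mono h (hs ⟨h1, h2⟩)

theorem norm_sub_le_fInf {f : ℝ → ℂ} (hf : LocallyACOffZero f) {R x y : ℝ} (hR : fInf f R ≠ ∞)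
    (hxy : x ≤ y) (h : 0 < x ∧ y ≤ R ∨ y < 0 ∧ -R ≤ x) :
    ‖f x - f y‖ ≤ (fInf f R).toReal * (y - x) := by
  have h0 : (0 : ℝ) ∉ uIcc x y := by
    rw [uIcc_of_le hxy]
    rintro ⟨h1, h2⟩
    rcases h with h | h <;> linarith
  rw [norm_sub_rev]
  refine norm_sub_le_of_ae_norm_deriv_le hxy (hf x y h0) ?_
  filter_upwards [ae_norm_deriv_le_fInf hR] with s hs hmem
  have h1 : s ≠ 0 := by
    rintro rfl
    exact h0 (by rw [uIcc_of_le hxy]; exact Ioo_subset_Icc_self hmem)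
  refine hs (abs_pos.2 h1) (le_trans ?_ (le_abs_self R))
  rw [abs_le]
  rcases h with h | h
  · exact ⟨by linarith [hmem.1, hmem.2], by linarith [hmem.2]⟩
  · exact ⟨by linarith [hmem.1], by linarith [hmem.1, hmem.2]⟩

/-- A zero value would make f, hence f', vanish near infinity. Positivity of f₀ is what lets a
finite A_δ force f_∞ to be finite. -/
theorem f0_ne_zero {f : ℝ → ℂ} (hb : ∀ r : ℝ, 0 < r → ¬ DerivBoundedOutside f r) (t : ℝ) :
    f0 f t ≠ 0 := by
  intro h
  have hz : ∀ s, |t| ≤ |s| → f s = 0 := fun s hs => by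
    have := (enorm_le_f0 f hs).trans_eq h
    simpa using this
  refine hb (|t| + 1) (by positivity) ⟨0, Filter.Eventually.of_forall fun s hs => ?_⟩
  have hev : f =ᶠ[nhds s] fun _ => 0 := by
    filter_upwards [continuous_abs.continuousAt.eventually (lt_mem_nhds (show |t| < |s| by linarith))]
      with x hx using hz x hx.le
  rw [hev.deriv_eq]
  simp

/-- With x = A/F the two terms are A xᵖ and A x^{(p-1)/2}, and the second power is at most 1 + xᵖ.
-/
theorem rpow_mul_rpow_le {A F p : ℝ} (hA : 0 < A) (hF : 0 < F) (hp : 1 < p) :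
    (A ^ (1 + 1 / p) / F) ^ p + (A ^ (1 + 1 / p)) ^ (p / 2) * F ^ ((1 - p) / 2)
      ≤ 2 * (A * (1 + A ^ p * F ^ (-p))) := by
  have hp0 : p ≠ 0 := by positivity
  set x := A / F with hx
  have hx0 : 0 < x := by positivity
  have e1 : (A ^ (1 + 1 / p) / F) ^ p = A * x ^ p := by
    rw [hx, Real.div_rpow (by positivity) hF.le, Real.div_rpow hA.le hF.le, ← Real.rpow_mul hA.le,
      show (1 + 1 / p) * p = 1 + p by field_simp; ring, Real.rpow_add hA, Real.rpow_one]
    ring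
  have e2 : (A ^ (1 + 1 / p)) ^ (p / 2) * F ^ ((1 - p) / 2) = A * x ^ ((p - 1) / 2) := by
    rw [hx, Real.div_rpow hA.le hF.le, ← Real.rpow_mul hA.le,
      show (1 + 1 / p) * (p / 2) = 1 + (p - 1) / 2 by field_simp; ring, Real.rpow_add hA,
      Real.rpow_one, show (1 - p) / 2 = -((p - 1) / 2) by ring, Real.rpow_neg hF.le]
    ring
  have e3 : A ^ p * F ^ (-p) = x ^ p := by
    rw [hx, Real.div_rpow hA.le hF.le, Real.rpow_neg hF.le]; ring
  have hle : x ^ ((p - 1) / 2) ≤ 1 + x ^ p := by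
    have h0 : 0 ≤ x ^ p := by positivity
    rcases le_total x 1 with h | h
    · have := Real.rpow_le_one hx0.le h (show 0 ≤ (p - 1) / 2 by linarith)
      linarith
    · have := Real.rpow_le_rpow_of_exponent_le h (show (p - 1) / 2 ≤ p by linarith)
      linarith
  rw [e1, e2, e3]
  have h4 := mul_le_mul_of_nonneg_left hle hA.le
  nlinarith

theorem repBound_half {f : ℝ → ℂ} {u F : ℕ → ℝ} {M p : ℝ} (hM : 0 ≤ M) (hp : 1 < p)
    (hF0 : 0 < F 1) (hF : Monotone F) (hfz : ∀ t, |t| ≤ 2 * Real.pi → f t = 0)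
    (hu : ∀ k : ℕ, 1 ≤ k → ∀ t, 2 * Real.pi * k ≤ t → ‖f t‖ ≤ u k)
    (hLip : ∀ k : ℕ, 1 ≤ k → ∀ x y, 0 < x → x ≤ y → y ≤ 2 * Real.pi * k + 2 * Real.pi →
      ‖f x - f y‖ ≤ F k * (y - x))
    (huF : ∀ k : ℕ, 1 ≤ k → u k ≤ (M / (k * F k)) ^ p) :
    RepBound (fun t => f (max t 0)) (ENNReal.ofReal (77 * (1 - (2 : ℝ) ^ ((1 - p) / 2))⁻¹ *
      ((M / F 1) ^ p + M ^ (p / 2) * F 1 ^ ((1 - p) / 2)))) := by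
  have hπ := Real.pi_pos
  have hz : ∀ t, t ≤ 2 * Real.pi → f (max t 0) = 0 := fun t ht => hfz _ (by
    rw [abs_of_nonneg (le_max_right _ _)]
    exact max_le ht (by positivity))
  refine RepBound.of_doubling hM hp hF0 hF hz (fun k hk t ht => ?_) (fun k hk x y hxy hy => ?_) huF
  · rw [max_eq_left (le_trans (by positivity) ht)]
    exact hu k hk t ht
  · have hFk : 0 < F k := hF0.trans_le (hF hk)
    rcases le_total y (2 * Real.pi) with h | h
    · rw [hz y h, hz x (hxy.trans h), sub_zero, norm_zero]
      exact mul_nonneg hFk.le (sub_nonneg.2 hxy)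
    -- Moving x up to at least 2π keeps the interval away from 0, where absolute continuity is not
    -- assumed.
    · have hx : f (max x 0) = f (max x (2 * Real.pi)) := by
        rcases le_total x (2 * Real.pi) with h' | h'
        · rw [hz x h', max_eq_right h', hfz _ (by rw [abs_of_pos (by positivity)])]
        · rw [max_eq_left (le_trans (by positivity) h'), max_eq_left h']
      rw [hx, max_eq_left (le_trans (by positivity) h)]
      refine (hLip k hk _ y (lt_max_of_lt_right (by positivity)) (max_le hxy h) hy).trans ?_
      gcongr
      exact le_max_left _ _

theorem repBound_of_ADelta_lt_top {δ : ℝ} (h0 : 0 < δ) (h1 : δ < 1) (f : C₀(ℝ, ℂ))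
    (hf : LocallyACOffZero f) (hb : ∀ r : ℝ, 0 < r → ¬ DerivBoundedOutside f r)
    (hfz : ∀ t : ℝ, |t| ≤ 2 * Real.pi → f t = 0) (hF0 : 0 < fInf f (4 * Real.pi))
    (hA : ADelta δ f < ∞) :
    RepBound f (ENNReal.ofReal (308 * (1 - (2 : ℝ) ^ ((1 - 1 / δ) / 2))⁻¹) * ADelta δ f *
      (1 + ADelta δ f ^ (1 / δ) * fInf f (4 * Real.pi) ^ (-(1 / δ)))) := by
  have hπ := Real.pi_gt_three
  have hp : 1 < 1 / δ := by rw [lt_div_iff₀ h0]; linarith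
  set S : ℝ≥0∞ := ⨆ (t : ℝ) (_ : 2 * Real.pi ≤ t),
    ENNReal.ofReal t * f0 f t ^ δ * fInf f (t + 2 * Real.pi) with hS
  have hAS : ADelta δ f = S ^ (1 / (1 + δ)) := rfl
  have hST : S ≠ ∞ := by
    intro h
    rw [hAS, h, ENNReal.top_rpow_of_pos (by positivity)] at hA
    exact hA.ne rfl
  have hle : ∀ t : ℝ, 2 * Real.pi ≤ t →
      ENNReal.ofReal t * f0 f t ^ δ * fInf f (t + 2 * Real.pi) ≤ S := fun t ht =>
    le_iSup₂ (f := fun (t : ℝ) (_ : 2 * Real.pi ≤ t) =>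
      ENNReal.ofReal t * f0 f t ^ δ * fInf f (t + 2 * Real.pi)) t ht
  have hft : ∀ t : ℝ, f0 f t ≠ ∞ := f0_ne_top f
  have hfn : ∀ t : ℝ, f0 f t ≠ 0 := f0_ne_zero hb
  have hpos : ∀ t : ℝ, 2 * Real.pi ≤ t → ENNReal.ofReal t * f0 f t ^ δ ≠ 0 := fun t ht =>
    mul_ne_zero (by simpa using (show (0 : ℝ) < t by linarith))
      (by simp [ENNReal.rpow_eq_zero_iff, hfn t, hft t])
  have hFt : ∀ t : ℝ, 2 * Real.pi ≤ t → fInf f (t + 2 * Real.pi) ≠ ∞ := by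
    intro t ht h
    have := hle t ht
    rw [h, ENNReal.mul_top (hpos t ht)] at this
    exact hST (top_le_iff.1 this)
  set u : ℕ → ℝ := fun k => (f0 f (2 * Real.pi * k)).toReal with hu
  set F : ℕ → ℝ := fun k => (fInf f (2 * Real.pi * k + 2 * Real.pi)).toReal with hFdef
  have hk2 : ∀ k : ℕ, 1 ≤ k → 2 * Real.pi ≤ 2 * Real.pi * k := fun k hk => by
    have : (1 : ℝ) ≤ k := by exact_mod_cast hk
    nlinarith
  have hFk : ∀ k : ℕ, fInf f (2 * Real.pi * k + 2 * Real.pi) ≠ ∞ := by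
    intro k
    have hk : (0 : ℝ) ≤ k := by positivity
    -- Comparison with k + 1 also covers k = 0, needed for monotonicity on all of ℕ.
    refine ne_top_of_le_ne_top (hFt (2 * Real.pi * (k + 1)) (by nlinarith)) (fInf_mono f ?_)
    rw [abs_of_pos (by positivity), abs_of_pos (by positivity)]
    nlinarith
  have hFmono : Monotone F := by
    intro i j hij
    have hij' : (i : ℝ) ≤ j := by exact_mod_cast hij
    refine ENNReal.toReal_mono (hFk j) (fInf_mono f ?_)
    rw [abs_of_pos (by positivity), abs_of_pos (by positivity)]
    nlinarith
  have hF1e : fInf f (4 * Real.pi) = fInf f (2 * Real.pi * (1 : ℕ) + 2 * Real.pi) := by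
    congr 1; push_cast; ring
  have hF1 : 0 < F 1 := ENNReal.toReal_pos (hF1e ▸ hF0.ne') (hFk 1)
  have hu0 : ∀ k, 0 < u k := fun k => ENNReal.toReal_pos (hfn _) (hft _)
  have hAM : ∀ k : ℕ, 1 ≤ k → 2 * Real.pi * k * u k ^ δ * F k ≤ S.toReal := by
    intro k hk
    have := ENNReal.toReal_mono hST (hle _ (hk2 k hk))
    rwa [ENNReal.toReal_mul, ENNReal.toReal_mul, ENNReal.toReal_ofReal (by positivity),
      ← ENNReal.toReal_rpow] at this
  have hM0 : 0 < S.toReal := by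
    refine lt_of_lt_of_le ?_ (hAM 1 le_rfl)
    have := hu0 1
    positivity
  have huF : ∀ k : ℕ, 1 ≤ k → u k ≤ (S.toReal / (k * F k)) ^ (1 / δ) := by
    intro k hk
    have hkF : 0 < k * F k := mul_pos (by exact_mod_cast hk) (hF1.trans_le (hFmono hk))
    have h3 : u k ^ δ ≤ S.toReal / (k * F k) := by
      rw [le_div_iff₀ hkF]
      refine le_trans ?_ (hAM k hk)
      have : 0 ≤ u k ^ δ * (k * F k) := mul_nonneg (Real.rpow_nonneg (hu0 k).le _) hkF.le
      nlinarith
    calc u k = (u k ^ δ) ^ (1 / δ) := by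
          rw [← Real.rpow_mul (hu0 k).le, mul_one_div_cancel h0.ne', Real.rpow_one]
      _ ≤ _ := Real.rpow_le_rpow (Real.rpow_nonneg (hu0 k).le _) h3 (by positivity)
  have hbd : ∀ k : ℕ, ∀ t, 2 * Real.pi * k ≤ |t| → ‖f t‖ ≤ u k := by
    intro k t ht
    rw [← toReal_enorm]
    exact ENNReal.toReal_mono (hft _) (enorm_le_f0 f (by rwa [abs_of_nonneg (by positivity)]))
  have hpos := repBound_half (f := f) (u := u) (F := F) hM0.le hp hF1 hFmono hfz
    (fun k _ t ht => hbd k t (ht.trans (le_abs_self t)))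
    (fun k _ x y hx hxy hy => norm_sub_le_fInf hf (hFk k) hxy (Or.inl ⟨hx, hy⟩)) huF
  have hneg := repBound_half (f := fun t => f (-t)) (u := u) (F := F) hM0.le hp hF1 hFmono
    (fun t ht => hfz (-t) (by rwa [abs_neg]))
    (fun k _ t ht => hbd k (-t) (by rw [abs_neg]; exact ht.trans (le_abs_self t)))
    (fun k _ x y hx hxy hy => by
      have := norm_sub_le_fInf hf (hFk k) (x := -y) (y := -x) (by linarith)
        (Or.inr ⟨by linarith, by linarith⟩)
      rw [norm_sub_rev]
      convert this using 2
      ring) huF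
  -- f is the sum of its two halves because f(0) = 0; the constant is 2 · 77 · 2 = 308.
  have hall := hpos.add hneg.comp_neg
  have e : (fun t => f (max t 0) + f (-max (-t) 0)) = f := by
    ext t
    have hz : f 0 = 0 := hfz 0 (by rw [abs_zero]; positivity)
    rcases le_total 0 t with h | h
    · rw [max_eq_left h, max_eq_right (by linarith), neg_zero, hz, add_zero]
    · rw [max_eq_right h, max_eq_left (by linarith), neg_neg, hz, zero_add]
  rw [e] at hall
  refine hall.mono ?_
  set A : ℝ := (ADelta δ f).toReal with hAdef
  have hA0 : 0 < A := by
    rw [hAdef, hAS, ← ENNReal.toReal_rpow]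
    positivity
  have hSA : S.toReal = A ^ (1 + 1 / (1 / δ)) := by
    rw [hAdef, hAS, ← ENNReal.toReal_rpow, ← Real.rpow_mul hM0.le, one_div_one_div,
      one_div_mul_cancel (by positivity), Real.rpow_one]
  have hr1 : (2 : ℝ) ^ ((1 - 1 / δ) / 2) < 1 :=
    Real.rpow_lt_one_of_one_lt_of_neg (by norm_num) (by linarith)
  have hκ : 0 < (1 - (2 : ℝ) ^ ((1 - 1 / δ) / 2))⁻¹ := inv_pos.2 (by linarith)
  set κ := (1 - (2 : ℝ) ^ ((1 - 1 / δ) / 2))⁻¹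
  have hAe : ADelta δ f = ENNReal.ofReal A := (ENNReal.ofReal_toReal hA.ne).symm
  have hFe : fInf f (4 * Real.pi) = ENNReal.ofReal (F 1) := by
    rw [hF1e]; exact (ENNReal.ofReal_toReal (hFk 1)).symm
  rw [hAe, hFe, ENNReal.ofReal_rpow_of_pos hA0, ENNReal.ofReal_rpow_of_pos hF1,
    ← ENNReal.ofReal_mul (by positivity), ← ENNReal.ofReal_mul (by positivity),
    ← ENNReal.ofReal_one, ← ENNReal.ofReal_add zero_le_one (by positivity),
    ← ENNReal.ofReal_mul (by positivity), ← ENNReal.ofReal_add (by positivity) (by positivity)]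
  apply ENNReal.ofReal_le_ofReal
  have hfin := rpow_mul_rpow_le (A := A) (F := F 1) (p := 1 / δ) hA0 hF1 hp
  rw [← hSA] at hfin
  have := mul_le_mul_of_nonneg_left hfin (show 0 ≤ 154 * κ by positivity)
  linarith

end FourierIntegral

theorem theorem1p1 :
    (∃ c : ℝ≥0, 0 < c ∧ ∀ f : C₀(ℝ, ℂ),
      FourierIntegral.LocallyACOffZero f →
      (∀ r : ℝ, 0 < r → FourierIntegral.DerivBoundedOutside f r) →
      FourierIntegral.A0 f < ∞ →
      FourierIntegral.A1 f < ∞ →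
      FourierIntegral.A01 f < ∞ →
      FourierIntegral.MemA f ∧
        FourierIntegral.normA f ≤
          c * (FourierIntegral.A0 f + FourierIntegral.A1 f + FourierIntegral.A01 f)) ∧
    (∀ δ : ℝ, 0 < δ → δ < 1 → ∃ γ : ℝ≥0, 0 < γ ∧ ∀ f : C₀(ℝ, ℂ),
      FourierIntegral.LocallyACOffZero f →
      (∀ r : ℝ, 0 < r → ¬ FourierIntegral.DerivBoundedOutside f r) →
      (∀ t : ℝ, |t| ≤ 2 * Real.pi → f t = 0) →
      0 < FourierIntegral.fInf f (4 * Real.pi) →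
      FourierIntegral.ADelta δ f < ∞ →
      FourierIntegral.MemA f ∧
        FourierIntegral.normA f ≤
          γ * FourierIntegral.ADelta δ f *
            (1 + FourierIntegral.ADelta δ f ^ (1 / δ) *
              FourierIntegral.fInf f (4 * Real.pi) ^ (-(1 / δ)))) := by
  refine ⟨⟨1000, by norm_num, fun f hf hb h0 h1 h01 => ?_⟩, fun δ h0 h1 => ?_⟩
  · have h := FourierIntegral.repBound_of_A_lt_top f hf hb h0 h1 h01
    exact ⟨h.memA, h.normA_le.trans_eq (by norm_num)⟩
  · have hr : (2 : ℝ) ^ ((1 - 1 / δ) / 2) < 1 := by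
      have : 1 < 1 / δ := by rw [lt_div_iff₀ h0]; linarith
      exact Real.rpow_lt_one_of_one_lt_of_neg (by norm_num) (by linarith)
    have hγ : 0 < 308 * (1 - (2 : ℝ) ^ ((1 - 1 / δ) / 2))⁻¹ :=
      mul_pos (by norm_num) (inv_pos.2 (by linarith))
    refine ⟨(308 * (1 - (2 : ℝ) ^ ((1 - 1 / δ) / 2))⁻¹).toNNReal, Real.toNNReal_pos.2 hγ,
      fun f hf hb hfz hF hA => ?_⟩
    have h := FourierIntegral.repBound_of_ADelta_lt_top h0 h1 f hf hb hfz hF hA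
    exact ⟨h.memA, h.normA_le⟩
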